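/- Let $(\mathcal Y,\mu)$ be a $\sigma$-finite measure space, let $K^*\ge 1$, and let $\mathbf Q^*$ be an irreducible invertible $K^*\times K^*$ transition matrix with stationary distribution $\pi^*$. Let $\mathbf f^*=(f_1^*,\dots,f_{K^*}^*)$ be a linearly independent family of probability densities with respect to $\mu$ that belong to $\mathbf L^2(\mathcal Y,\mu)$. Let $(X_j,Y_j)_{j\ge1}$ be a stationary hidden Markov model: $(X_j)_{j\ge1}$ is a Markov chain on $\{1,\dots,K^*\}$ with initial distribution $\pi^*$ and transition matrix $\mathbf Q^*$ and, conditionally on $(X_j)_{j\ge 1}$, the $Y_j$ are independent, $Y_j$ having density $f^*_{X_j}$ with respect to $\mu$. Let $\mathcal M\subset\mathbb N$ and let $(\mathfrak P_M)_{M\in\mathcal M}$ be nested subspaces of $\mathbf L^2(\mathcal Y,\mu)$ with $\dim\mathfrak P_M=M$ and with dense union. For $M\in\mathcal M$ let $\Phi_M=(\varphi_1,\dots,\varphi_M)$ be an orthonormal basis of $\mathfrak P_M$, and for $a,b\in\{1,\dots,M\}$, $k\in\{1,\dots,K^*\}$ and $n\ge1$ put $$\mathbf N_M(a,b)=\mathbb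 E[\varphi_a(Y_1)\varphi_b(Y_2)],\qquad \hat{\mathbf N}_M(a,b)=\frac1n\sum_{s=1}^n\varphi_a(Y_s)\varphi_b(Y_{s+1}),\qquad \mathbf O_M(a,k)=\int\varphi_a f^*_k\,d\mu .$$ For a matrix $A$ let $\sigma_1(A)\ge\sigma_2(A)\ge\dots$ be its singular values, and for $C>0$ let $$\hat K_{\mathrm{sp.}}(C)=\#\bigl\{\,i\in\{1,\dots,M\} : \sigma_i(\hat{\mathbf N}_M)>C\sqrt{\log(n)/n}\,\bigr\}.$$ There is $M_0\in\mathcal M$, depending only on $\mathbf Q^*$, $(\Phi_M)_{M\in\mathcal M}$ and $\mathbf f^*$, such that $\mathbf N_M$ has rank $K^*$ for all $M\in\mathcal M$ with $M\ge M_0$. Moreover, for any $M_0$ with this rank property and any $M\in\mathcal M$ with $M\ge M_0$ such that the functions $\varphi_1,\dots,\varphi_M$ are ($\mu$-essentially) bounded, there exist $C_0>0$ depending only on $\mathbf Q^*$ and $\Phi_M$, and $n_0>0$ depending only on $\mathbf Q^*$, $\Phi_M$ and $\mathbf O_M$, such that for all $C\ge C_0$ and all integers $n\ge n_0C^2(1+\log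 C)$, $$\mathbb P\bigl(\hat K_{\mathrm{sp.}}(C)\ne K^*\bigr)\le n^{-2},$$ and for every $C\ge C_0$, $\hat K_{\mathrm{sp.}}(C)\to K^*$ almost surely as $n\to\infty$. -/

import Mathlib

open MeasureTheory Filter Topology
open scoped ENNReal

noncomputable section

namespace SpectralHMM

/-- A nested family of subspaces `𝔓 M` of `L²(μ)`, indexed by `M ∈ ℳ`, with `dim 𝔓 M = M` and
dense union. -/
structure IsApproximationFamily {𝒴 : Type*} [MeasurableSpace 𝒴] (μ : Measure 𝒴)
    (ℳ : Set ℕ) (𝔓 : ℕ → Submodule ℝ (Lp ℝ 2 μ)) : Prop where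
  nested : ∀ M ∈ ℳ, ∀ M' ∈ ℳ, M ≤ M' → 𝔓 M ≤ 𝔓 M'
  rank_eq : ∀ M ∈ ℳ, Module.rank ℝ (𝔓 M) = M
  dense : Dense (⋃ M ∈ ℳ, (𝔓 M : Set (Lp ℝ 2 μ)))

/-- `φ` is an orthonormal basis of the subspace `V` of `L²(μ)`. -/
structure IsOrthonormalBasisOf {𝒴 : Type*} [MeasurableSpace 𝒴] {μ : Measure 𝒴} {M : ℕ}
    (φ : Fin M → Lp ℝ 2 μ) (V : Submodule ℝ (Lp ℝ 2 μ)) : Prop where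
  orthonormal : Orthonormal ℝ φ
  span_eq : Submodule.span ℝ (Set.range φ) = V

/-- The measure with density `f` with respect to `μ`. -/
def emission {𝒴 : Type*} [MeasurableSpace 𝒴] {μ : Measure 𝒴} (f : Lp ℝ 2 μ) : Measure 𝒴 :=
  μ.withDensity fun y => ENNReal.ofReal (f y)

/-- `f` is a probability density with respect to `μ`. -/
structure IsProbDensity {𝒴 : Type*} [MeasurableSpace 𝒴] {μ : Measure 𝒴} (f : Lp ℝ 2 μ) :
    Prop where
  nonneg : ∀ᵐ y ∂μ, 0 ≤ f y
  lintegral_eq_one : ∫⁻ y, ENNReal.ofReal (f y) ∂μ = 1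

/-- `(X_j, Y_j)` (indexed from `j = 0`) is a hidden Markov model on the probability space `(Ω, P)`
with initial distribution `π`, transition matrix `Q` and emission densities `f`: the hidden
sequence `X` is a Markov chain with parameters `(π, Q)` and, conditionally on `X`, the variables
`Y_j` are independent with respective densities `f (X_j)`. -/
structure IsHMM {𝒴 : Type*} [MeasurableSpace 𝒴] {μ : Measure 𝒴} {K : ℕ}
    {Ω : Type*} [MeasurableSpace Ω] (P : Measure Ω)
    (π : Fin K → ℝ) (Q : Matrix (Fin K) (Fin K) ℝ) (f : Fin K → Lp ℝ 2 μ)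
    (X : ℕ → Ω → Fin K) (Y : ℕ → Ω → 𝒴) : Prop where
  measurable_hidden : ∀ j, Measurable (X j)
  measurable_obs : ∀ j, Measurable (Y j)
  markov : ∀ (m : ℕ) (x : ℕ → Fin K),
    P {ω | ∀ j ≤ m, X j ω = x j} =
      ENNReal.ofReal (π (x 0) * ∏ j ∈ Finset.range m, Q (x j) (x (j + 1)))
  condIndep : ∀ (m : ℕ) (x : ℕ → Fin K) (A : ℕ → Set 𝒴), (∀ j, MeasurableSet (A j)) →
    P {ω | ∀ j ≤ m, X j ω = x j ∧ Y j ω ∈ A j} =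
      P {ω | ∀ j ≤ m, X j ω = x j} * ∏ j ∈ Finset.range (m + 1), emission (f (x j)) (A j)

/-- The matrix `O_M(m, k) = ∫ φ_m f_k dμ`. -/
def emissionMatrix {𝒴 : Type*} [MeasurableSpace 𝒴] {μ : Measure 𝒴} {M K : ℕ}
    (φ : Fin M → Lp ℝ 2 μ) (f : Fin K → Lp ℝ 2 μ) : Matrix (Fin M) (Fin K) ℝ :=
  Matrix.of fun m k => ∫ y, φ m y * f k y ∂μ

/-- The matrix `N_M(a, b) = 𝔼[φ_a(Y_1) φ_b(Y_2)]`; the first two observations are `Y 0`, `Y 1`. -/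
def momentMatrix {𝒴 : Type*} [MeasurableSpace 𝒴] {μ : Measure 𝒴} {M : ℕ}
    {Ω : Type*} [MeasurableSpace Ω] (P : Measure Ω)
    (φ : Fin M → Lp ℝ 2 μ) (Y : ℕ → Ω → 𝒴) : Matrix (Fin M) (Fin M) ℝ :=
  Matrix.of fun a b => ∫ ω, φ a (Y 0 ω) * φ b (Y 1 ω) ∂P

/-- The empirical matrix `N̂_M(a, b) = n⁻¹ ∑_{s=1}^n φ_a(y_s) φ_b(y_{s+1})` of an observed sequence
`y`, indexed from `0`. -/
def empiricalMatrix {𝒴 : Type*} [MeasurableSpace 𝒴] {μ : Measure 𝒴} {M : ℕ}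
    (φ : Fin M → Lp ℝ 2 μ) (n : ℕ) (y : ℕ → 𝒴) : Matrix (Fin M) (Fin M) ℝ :=
  Matrix.of fun a b => (1 / (n : ℝ)) * ∑ s ∈ Finset.range n, φ a (y s) * φ b (y (s + 1))

/-- The `i`-th singular value of a square matrix, in decreasing order, indexed from `0`. -/
def singularValue {M : ℕ} (A : Matrix (Fin M) (Fin M) ℝ) (i : Fin M) : ℝ :=
  (Matrix.toEuclideanLin A).singularValues i

/-- The spectral order estimator `K̂_sp(C)`: the number of singular values of the empirical matrix
which exceed `C √(log n / n)`. -/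
def spectralOrder {𝒴 : Type*} [MeasurableSpace 𝒴] {μ : Measure 𝒴} {M : ℕ}
    (φ : Fin M → Lp ℝ 2 μ) (C : ℝ) (n : ℕ) (y : ℕ → 𝒴) : ℕ :=
  Nat.card {i : Fin M //
    C * Real.sqrt (Real.log n / n) < singularValue (empiricalMatrix φ n y) i}

end SpectralHMM

end

/-! Conditioning on the two hidden states gives `N = O diag(π) Q Oᵀ`. Irreducibility makes `π`
positive, so the middle factor is invertible and `N` has rank `K` as soon as `O` is injective.
Injectivity holds for large `M`: the projections of the densities onto the dense nested subspaces
approach the densities, and linear independence is an open condition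
(`exists_emissionMatrix_injective`, `rank_mul_mul_transpose`).

A Weyl-type perturbation argument (`exists_margin_card_singularValue`) then reduces consistency to
an entrywise bound on `N̂ - N`. If the error in operator norm is at most the threshold, and the
threshold is below half of a lower bound for the nonzero singular values of `N`, then exactly `rank
N` singular values of `N̂` exceed the threshold.

The entrywise bound comes from a martingale decomposition. The Poisson equation of the hidden chain
(`exists_poisson`) turns the centred sum into a sum of bounded, conditionally centred increments
plus a bounded boundary term, and an Azuma–Hoeffding bound applies. Neither aperiodicity nor mixing
is needed. The noise level involves only `Q` and the sup norms of the basis, hence `C₀`; the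
singular value margin also involves `O`, hence `n₀`. Borel–Cantelli gives almost sure convergence.
-/

namespace SpectralHMM

/-! ### Variational bounds and perturbation of singular values. -/

section SingularValues

variable {E : Type*} [NormedAddCommGroup E] [InnerProductSpace ℝ E] [FiniteDimensional ℝ E]

/-- The squared norm of `T v` in a basis of right singular vectors of `T`. -/
theorem norm_sq_apply_eq_sum (T : E →ₗ[ℝ] E) {n : ℕ} (hn : Module.finrank ℝ E = n) (v : E) :
    ‖T v‖ ^ 2 = ∑ j : Fin n, T.singularValues j ^ 2 *
      inner ℝ (T.isSymmetric_adjoint_comp_self.eigenvectorBasis hn j) v ^ 2 := by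
  set b := T.isSymmetric_adjoint_comp_self.eigenvectorBasis hn with hb
  have h1 : ‖T v‖ ^ 2 = inner ℝ v ((LinearMap.adjoint T ∘ₗ T) v) := by
    rw [LinearMap.comp_apply, LinearMap.adjoint_inner_right, real_inner_self_eq_norm_sq]
  rw [h1, ← b.sum_inner_mul_inner]
  refine Finset.sum_congr rfl fun j _ => ?_
  rw [← T.isSymmetric_adjoint_comp_self, hb,
    T.isSymmetric_adjoint_comp_self.apply_eigenvectorBasis, ← hb, T.sq_singularValues_fin hn,
    RCLike.ofReal_real_eq_id, id_eq, real_inner_smul_left, real_inner_comm v]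
  ring

/-- A subspace of dimension larger than the number of linear constraints contains a nonzero vector
satisfying all of them. -/
theorem exists_ne_zero_orthogonal {ι : Type*} [Fintype ι] (V : Submodule ℝ E) (b : ι → E)
    (h : Fintype.card ι < Module.finrank ℝ V) :
    ∃ v ∈ V, v ≠ 0 ∧ ∀ j, inner ℝ (b j) v = 0 := by
  let L : V →ₗ[ℝ] (ι → ℝ) := LinearMap.pi fun j => (innerₛₗ ℝ (b j)).comp V.subtype
  have hL : LinearMap.ker L ≠ ⊥ := LinearMap.ker_ne_bot_of_finrank_lt (by simpa using h)
  obtain ⟨v, hv, hv0⟩ := (Submodule.ne_bot_iff _).1 hL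
  refine ⟨v, v.2, by simpa using hv0, fun j => ?_⟩
  have := congrFun (LinearMap.mem_ker.1 hv) j
  simpa [L] using this

/-- A lower bound for a singular value from a subspace on which the map is bounded below. -/
theorem le_singularValues_of_le_norm (T : E →ₗ[ℝ] E) {i : ℕ} (V : Submodule ℝ E)
    (hV : i < Module.finrank ℝ V) {s : ℝ} (hs : ∀ v ∈ V, s * ‖v‖ ≤ ‖T v‖) :
    s ≤ T.singularValues i := by
  rcases le_or_gt s 0 with hs0 | hs0
  · exact hs0.trans (T.singularValues_nonneg i)
  set b := T.isSymmetric_adjoint_comp_self.eigenvectorBasis rfl with hb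
  have hin : i < Module.finrank ℝ E := hV.trans_le (Submodule.finrank_le V)
  -- Courant–Fischer: being orthogonal to the first `i` right singular vectors is only `i`
  -- constraints, and on such a `v` only the singular values of index at least `i` act.
  obtain ⟨v, hvV, hv0, hv⟩ := exists_ne_zero_orthogonal V
    (fun j : Fin i => b ⟨j, j.2.trans hin⟩) (by simpa using hV)
  have hv' : 0 < ‖v‖ := norm_pos_iff.2 hv0
  have h1 : ‖T v‖ ^ 2 ≤ T.singularValues i ^ 2 * ‖v‖ ^ 2 := by
    rw [norm_sq_apply_eq_sum T rfl v, ← hb, ← b.sum_sq_inner_right, Finset.mul_sum]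
    refine Finset.sum_le_sum fun j _ => ?_
    rcases lt_or_ge (j : ℕ) i with hj | hj
    · have := hv ⟨j, hj⟩
      simp only [Fin.eta] at this
      simp [this]
    · gcongr
      · exact T.singularValues_nonneg _
      · exact T.singularValues_antitone hj
  have h2 : ‖T v‖ ≤ T.singularValues i * ‖v‖ := by
    refine abs_le_of_sq_le_sq' (by rw [mul_pow]; exact h1) ?_ |>.2
    exact mul_nonneg (T.singularValues_nonneg i) hv'.le
  exact le_of_mul_le_mul_right ((hs v hvV).trans h2) hv'

/-- An upper bound for a singular value from a subspace on which the map is bounded above. -/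
theorem singularValues_le_of_norm_le (T : E →ₗ[ℝ] E) {i : ℕ} (V : Submodule ℝ E)
    (hi : i < Module.finrank ℝ E)
    (hV : Module.finrank ℝ E ≤ Module.finrank ℝ V + i) {s : ℝ}
    (hs : ∀ v ∈ V, ‖T v‖ ≤ s * ‖v‖) :
    T.singularValues i ≤ s := by
  set b := T.isSymmetric_adjoint_comp_self.eigenvectorBasis rfl with hb
  -- Dual choice: `v` avoids the singular vectors of index greater than `i`, of which there are `dim
  -- E - 1 - i`, fewer than `dim V`.
  obtain ⟨v, hvV, hv0, hv⟩ := exists_ne_zero_orthogonal V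
    (fun j : Finset.Ioi (⟨i, hi⟩ : Fin (Module.finrank ℝ E)) => b j) (by
      simp only [Fintype.card_coe, Fin.card_Ioi]; omega)
  have hv' : 0 < ‖v‖ := norm_pos_iff.2 hv0
  have h1 : T.singularValues i ^ 2 * ‖v‖ ^ 2 ≤ ‖T v‖ ^ 2 := by
    rw [norm_sq_apply_eq_sum T rfl v, ← hb, ← b.sum_sq_inner_right, Finset.mul_sum]
    refine Finset.sum_le_sum fun j _ => ?_
    rcases le_or_gt (j : ℕ) i with hj | hj
    · gcongr
      · exact T.singularValues_nonneg _
      · exact T.singularValues_antitone hj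
    · have := hv ⟨j, by simpa [Fin.lt_def] using hj⟩
      simp only at this
      simp [this]
  have h2 : T.singularValues i * ‖v‖ ≤ ‖T v‖ :=
    abs_le_of_sq_le_sq' (by rw [mul_pow]; exact h1) (norm_nonneg _) |>.2
  exact le_of_mul_le_mul_right (h2.trans (hs v hvV)) hv'

/-- A linear map is bounded below on the orthogonal complement of its kernel. -/
theorem exists_le_norm_of_mem_ker_orthogonal (T : E →ₗ[ℝ] E) :
    ∃ s : ℝ, 0 < s ∧ ∀ v ∈ (LinearMap.ker T)ᗮ, s * ‖v‖ ≤ ‖T v‖ := by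
  have hker : LinearMap.ker (T.domRestrict (LinearMap.ker T)ᗮ) = ⊥ := by
    rw [LinearMap.ker_eq_bot']
    intro v hv
    have h1 : (v : E) ∈ LinearMap.ker T := by simpa using hv
    have h2 := (Submodule.mem_orthogonal _ _).1 v.2 _ h1
    simpa using h2
  obtain ⟨κ, hκ, h⟩ := LinearMap.exists_antilipschitzWith _ hker
  refine ⟨(κ : ℝ)⁻¹, by positivity, fun v hv => ?_⟩
  have := h.le_mul_dist ⟨v, hv⟩ 0
  simp only [dist_zero_right, map_zero, LinearMap.domRestrict_apply] at this
  rw [inv_mul_le_iff₀ (by positivity)]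
  exact this

/-- Perturbation of the singular values of a map of rank `K`. -/
theorem lt_singularValues_iff_of_norm_sub_le (T T' : E →ₗ[ℝ] E) {s ε : ℝ}
    (hs : ∀ v ∈ (LinearMap.ker T)ᗮ, s * ‖v‖ ≤ ‖T v‖) (hε : 2 * ε < s)
    (hTT' : ∀ v, ‖T' v - T v‖ ≤ ε * ‖v‖) {i : ℕ} (hi : i < Module.finrank ℝ E) :
    ε < T'.singularValues i ↔ i < Module.finrank ℝ (LinearMap.range T) := by
  have hdim := LinearMap.finrank_range_add_finrank_ker T
  have hdim' := Submodule.finrank_add_finrank_orthogonal (LinearMap.ker T)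
  constructor
  · intro h
    by_contra! hc
    -- On `ker T` the map `T'` is pure noise of size `ε`, and the codimension of `ker T` is the rank
    -- of `T`.
    refine h.not_ge (singularValues_le_of_norm_le T' (LinearMap.ker T) hi (by omega) ?_)
    intro v hv
    simpa [LinearMap.mem_ker.1 hv] using hTT' v
  · intro h
    have : s - ε ≤ T'.singularValues i := by
      refine le_singularValues_of_le_norm T' (LinearMap.ker T)ᗮ (by omega) fun v hv => ?_
      have h1 := hs v hv
      have h2 := hTT' v
      have h3 := norm_sub_norm_le (T v) (T' v)
      rw [norm_sub_rev] at h3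
      linarith
    linarith

end SingularValues

/-- The Euclidean operator norm of a matrix is controlled by its entries. -/
theorem norm_toEuclideanLin_le_of_entry_le {M : ℕ} (A : Matrix (Fin M) (Fin M) ℝ) {δ : ℝ}
    (hδ : 0 ≤ δ) (hA : ∀ a b, |A a b| ≤ δ) (v : EuclideanSpace ℝ (Fin M)) :
    ‖Matrix.toEuclideanLin A v‖ ≤ M * δ * ‖v‖ := by
  have h1 : ‖Matrix.toEuclideanLin A v‖ ^ 2 ≤ (M * δ * ‖v‖) ^ 2 := by
    rw [EuclideanSpace.norm_sq_eq]
    have h2 : ∀ a, ‖(Matrix.toEuclideanLin A v) a‖ ^ 2 ≤ M * δ ^ 2 * ‖v‖ ^ 2 := by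
      intro a
      have : (Matrix.toEuclideanLin A v) a = ∑ b, A a b * v b := by
        simp [Matrix.toEuclideanLin, Matrix.mulVec, dotProduct]
      rw [this, Real.norm_eq_abs, sq_abs, EuclideanSpace.norm_sq_eq]
      -- Cauchy–Schwarz on each row, which amounts to bounding the operator norm by the Frobenius
      -- norm.
      refine (Finset.sum_mul_sq_le_sq_mul_sq _ _ _).trans ?_
      simp only [Real.norm_eq_abs, sq_abs]
      gcongr
      calc ∑ b, A a b ^ 2 ≤ ∑ _b : Fin M, δ ^ 2 :=
            Finset.sum_le_sum fun b _ => sq_le_sq' (abs_le.1 (hA a b)).1 (abs_le.1 (hA a b)).2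
        _ = M * δ ^ 2 := by simp
    calc _ ≤ ∑ _a : Fin M, M * δ ^ 2 * ‖v‖ ^ 2 := Finset.sum_le_sum fun a _ => h2 a
      _ = _ := by simp; ring
  exact abs_le_of_sq_le_sq' h1 (by positivity) |>.2

/-- For a matrix `N` there is a margin `s` such that every matrix which is entrywise close to `N`
has as many large singular values as the rank of `N`. -/
theorem exists_margin_card_singularValue {M : ℕ} (N : Matrix (Fin M) (Fin M) ℝ) :
    ∃ s : ℝ, 0 < s ∧ ∀ (N' : Matrix (Fin M) (Fin M) ℝ) (ε δ : ℝ), 0 ≤ δ → M * δ ≤ ε →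
      2 * ε < s → (∀ a b, |N' a b - N a b| ≤ δ) →
      Nat.card {i : Fin M // ε < singularValue N' i} = N.rank := by
  obtain ⟨s, hs, h⟩ := exists_le_norm_of_mem_ker_orthogonal (Matrix.toEuclideanLin N)
  refine ⟨s, hs, fun N' ε δ hδ hMδ hε hN' => ?_⟩
  have hrank : N.rank = Module.finrank ℝ (LinearMap.range (Matrix.toEuclideanLin N)) := by
    rw [N.rank_eq_finrank_range_toLin (PiLp.basisFun 2 ℝ (Fin M)) (PiLp.basisFun 2 ℝ (Fin M)),
      ← Matrix.toLpLin_eq_toLin]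
  have hsub : ∀ v, ‖Matrix.toEuclideanLin N' v - Matrix.toEuclideanLin N v‖ ≤ ε * ‖v‖ := by
    intro v
    have := norm_toEuclideanLin_le_of_entry_le (N' - N) hδ (by simpa using hN') v
    rw [map_sub, LinearMap.sub_apply] at this
    exact this.trans (by gcongr)
  have hle : N.rank ≤ M := by simpa using N.rank_le_width
  have key : ∀ i : Fin M, ε < singularValue N' i ↔ (i : ℕ) < N.rank := fun i => by
    rw [hrank]
    exact lt_singularValues_iff_of_norm_sub_le _ _ h hε hsub (by simp)
  simp only [key]
  rw [Nat.card_eq_fintype_card, Fintype.card_subtype]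
  have := Fin.card_filter_val_lt (n := M) (m := N.rank)
  simpa [hle] using this

end SpectralHMM

namespace SpectralHMM

/-! ### Irreducible stochastic matrices and the Poisson equation. -/

section MarkovMatrix

variable {K : ℕ} {Q : Matrix (Fin K) (Fin K) ℝ}

/-- Harmonic vectors of an irreducible stochastic matrix are constant. -/
theorem eq_of_mulVec_eq_self (hQ : Q ∈ Matrix.rowStochastic ℝ (Fin K)) (hQirr : Q.IsIrreducible)
    {v : Fin K → ℝ} (hv : Q.mulVec v = v) (i j : Fin K) : v i = v j := by
  have : Nonempty (Fin K) := ⟨i⟩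
  obtain ⟨m, hm⟩ := Finite.exists_max v
  suffices h : ∀ l, v m = v l by rw [← h i, ← h j]
  intro l
  obtain ⟨k, -, hk⟩ := (Matrix.isIrreducible_iff_exists_pow_pos hQ.1).1 hQirr m l
  have hQk : Q ^ k ∈ Matrix.rowStochastic ℝ (Fin K) := pow_mem hQ k
  have hvk : (Q ^ k).mulVec v = v := by
    clear hk hQk
    induction k with
    | zero => simp
    | succ k ih => rw [pow_succ, ← Matrix.mulVec_mulVec, hv, ih]
  have hone : ∑ x, (Q ^ k) m x = 1 := by
    have := congrFun hQk.2 m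
    simpa [Matrix.mulVec, dotProduct] using this
  -- Maximum principle: the `Q ^ k`-average of `v` seen from a maximiser `m` equals `v m`, so `v`
  -- takes the value `v m` at every state charged by `Q ^ k`, in particular at `l`.
  have hsum : ∑ x, (Q ^ k) m x * (v m - v x) = 0 := by
    have := congrFun hvk m
    simp only [Matrix.mulVec, dotProduct] at this
    simp [mul_sub, Finset.sum_sub_distrib, ← Finset.sum_mul, hone, this]
  have := (Finset.sum_eq_zero_iff_of_nonneg fun x _ =>
    mul_nonneg (hQk.1 m x) (sub_nonneg.2 (hm x))).1 hsum l (Finset.mem_univ _)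
  rcases mul_eq_zero.1 this with h | h
  · exact absurd h hk.ne'
  · linarith

/-- A stationary distribution of an irreducible matrix is positive. -/
theorem stationary_pos (hQ : Q ∈ Matrix.rowStochastic ℝ (Fin K)) (hQirr : Q.IsIrreducible)
    {π : Fin K → ℝ} (hπ : π ∈ stdSimplex ℝ (Fin K)) (hst : Matrix.vecMul π Q = π) (i : Fin K) :
    0 < π i := by
  obtain ⟨j, hj⟩ : ∃ j, 0 < π j := by
    by_contra! h
    have := hπ.2 ▸ Finset.sum_nonpos fun j (_ : j ∈ Finset.univ) => h j
    linarith
  obtain ⟨k, -, hk⟩ := (Matrix.isIrreducible_iff_exists_pow_pos hQ.1).1 hQirr j i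
  have hQk : Q ^ k ∈ Matrix.rowStochastic ℝ (Fin K) := pow_mem hQ k
  have hvk : Matrix.vecMul π (Q ^ k) = π := by
    clear hk hQk
    induction k with
    | zero => simp
    | succ k ih => rw [pow_succ, ← Matrix.vecMul_vecMul, ih, hst]
  rw [← hvk]
  simp only [Matrix.vecMul, dotProduct]
  exact Finset.sum_pos' (fun x _ => mul_nonneg (hπ.1 x) (hQk.1 x i))
    ⟨j, Finset.mem_univ _, mul_pos hj hk⟩

/-- The inverse of the fundamental matrix `1 - Q + 𝟙 πᵀ` of a Markov chain. -/
def fundamentalInv (π : Fin K → ℝ) (Q : Matrix (Fin K) (Fin K) ℝ) :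
    Matrix (Fin K) (Fin K) ℝ :=
  1 - Q + Matrix.vecMulVec 1 π

/-- Taking `ρ = π` shows that `π` is fixed, so solving against this matrix preserves `π`-averages.
Taking for `ρ` another stationary distribution gives uniqueness, since both are sent to `π` by an
injective map. -/
theorem vecMul_fundamentalInv {π ρ : Fin K → ℝ} (hst : Matrix.vecMul ρ Q = ρ) :
    Matrix.vecMul ρ (fundamentalInv π Q) = (∑ i, ρ i) • π := by
  rw [fundamentalInv, Matrix.vecMul_add, Matrix.vecMul_sub, hst, Matrix.vecMul_one, sub_self,
    zero_add, Matrix.vecMul_vecMulVec]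
  simp [dotProduct]

theorem fundamentalInv_mulVec (π v : Fin K → ℝ) :
    (fundamentalInv π Q).mulVec v = v - Q.mulVec v + fun _ => dotProduct π v := by
  rw [fundamentalInv, Matrix.add_mulVec, Matrix.sub_mulVec, Matrix.one_mulVec,
    Matrix.vecMulVec_mulVec]
  ext i
  simp

/-- If `Z v = 0`, pairing with `π` gives `π v = 0`; then `v` is harmonic, hence constant, hence
equal to its own `π`-average, which is zero. Only the eigenvalue 1 of `Q` matters, so periodic
chains are allowed. -/
theorem isUnit_fundamentalInv (hQ : Q ∈ Matrix.rowStochastic ℝ (Fin K))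
    (hQirr : Q.IsIrreducible) {π : Fin K → ℝ} (hπ : π ∈ stdSimplex ℝ (Fin K))
    (hst : Matrix.vecMul π Q = π) : IsUnit (fundamentalInv π Q) := by
  rw [← Matrix.mulVec_injective_iff_isUnit]
  refine (injective_iff_map_eq_zero (Matrix.mulVecLin (fundamentalInv π Q))).2 fun v hv => ?_
  rw [Matrix.mulVecLin_apply] at hv
  have hπv : dotProduct π v = 0 := by
    have h := Matrix.dotProduct_mulVec π (fundamentalInv π Q) v
    rw [hv, vecMul_fundamentalInv hst, hπ.2, one_smul, dotProduct_zero] at h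
    exact h.symm
  have hQv : Q.mulVec v = v := by
    rw [fundamentalInv_mulVec, hπv] at hv
    ext i
    have := congrFun hv i
    simp at this
    linarith
  have hc := eq_of_mulVec_eq_self hQ hQirr hQv
  ext i
  have : dotProduct π v = v i := by
    simp only [dotProduct]
    rw [Finset.sum_congr rfl fun j _ => by rw [hc j i], ← Finset.sum_mul, hπ.2, one_mul]
  simpa [hπv] using this.symm

/-- The stationary distribution of an irreducible stochastic matrix is unique. -/
theorem stationary_unique (hQ : Q ∈ Matrix.rowStochastic ℝ (Fin K))
    (hQirr : Q.IsIrreducible) {π ρ : Fin K → ℝ} (hπ : π ∈ stdSimplex ℝ (Fin K))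
    (hst : Matrix.vecMul π Q = π) (hρ : ρ ∈ stdSimplex ℝ (Fin K))
    (hst' : Matrix.vecMul ρ Q = ρ) : ρ = π := by
  refine Matrix.vecMul_injective_iff_isUnit.2 (isUnit_fundamentalInv hQ hQirr hπ hst) ?_
  simp only [vecMul_fundamentalInv hst, vecMul_fundamentalInv hst', hπ.2, hρ.2]

/-- Solution of the Poisson equation of an irreducible chain, with a bound depending on the
transition matrix only. -/
theorem exists_poisson (hQ : Q ∈ Matrix.rowStochastic ℝ (Fin K))
    (hQirr : Q.IsIrreducible) {π : Fin K → ℝ} (hπ : π ∈ stdSimplex ℝ (Fin K))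
    (hst : Matrix.vecMul π Q = π) :
    ∃ L : ℝ, 0 ≤ L ∧ ∀ (h : Fin K → ℝ) (B : ℝ), (∀ i, |h i| ≤ B) →
      ∃ g : Fin K → ℝ, (∀ i, |g i| ≤ L * B) ∧
        ∀ i, g i - ∑ j, Q i j * g j = h i - ∑ j, π j * h j := by
  set Z := fundamentalInv π Q
  have hZ : IsUnit Z := isUnit_fundamentalInv hQ hQirr hπ hst
  have hZdet : IsUnit Z.det := (Matrix.isUnit_iff_isUnit_det Z).1 hZ
  refine ⟨∑ i, ∑ j, |Z⁻¹ i j|, by positivity, fun h B hB => ⟨Z⁻¹.mulVec h, fun i => ?_, ?_⟩⟩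
  · calc |Z⁻¹.mulVec h i| ≤ ∑ j, |Z⁻¹ i j * h j| := by
          rw [Matrix.mulVec, dotProduct]; exact Finset.abs_sum_le_sum_abs _ _
      _ ≤ ∑ j, |Z⁻¹ i j| * B := Finset.sum_le_sum fun j _ => by
          rw [abs_mul]; exact mul_le_mul_of_nonneg_left (hB j) (abs_nonneg _)
      _ = (∑ j, |Z⁻¹ i j|) * B := by rw [Finset.sum_mul]
      _ ≤ (∑ i, ∑ j, |Z⁻¹ i j|) * B := by
          refine mul_le_mul_of_nonneg_right ?_ ((abs_nonneg _).trans (hB i))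
          exact Finset.single_le_sum (f := fun i => ∑ j, |Z⁻¹ i j|)
            (fun _ _ => by positivity) (Finset.mem_univ i)
  · set g := Z⁻¹.mulVec h
    have hg : Z.mulVec g = h := by
      rw [Matrix.mulVec_mulVec, Matrix.mul_nonsing_inv _ hZdet, Matrix.one_mulVec]
    -- Since `Z g = g - Q g + π(g)`, the equation `Z g = h` becomes the Poisson equation once `π(g)`
    -- is replaced by `π(h)`.
    have hπg : dotProduct π g = dotProduct π h := by
      have := Matrix.dotProduct_mulVec π Z g
      rw [hg, vecMul_fundamentalInv hst, hπ.2, one_smul] at this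
      exact this.symm
    intro i
    have := congrFun hg i
    rw [fundamentalInv_mulVec, hπg] at this
    simp only [Pi.add_apply, Pi.sub_apply, Matrix.mulVec, dotProduct] at this
    linarith

end MarkovMatrix

/-! ### Rank of the population moment matrix. -/

section Rank

/-- The matrix `O diag(π) Q Oᵀ`. -/
def momentFactorization {M K : ℕ} (π : Fin K → ℝ) (Q : Matrix (Fin K) (Fin K) ℝ)
    (O : Matrix (Fin M) (Fin K) ℝ) : Matrix (Fin M) (Fin M) ℝ :=
  O * (Matrix.diagonal π * Q) * O.transpose

theorem momentFactorization_apply {M K : ℕ} (π : Fin K → ℝ) (Q : Matrix (Fin K) (Fin K) ℝ)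
    (O : Matrix (Fin M) (Fin K) ℝ) (a b : Fin M) :
    momentFactorization π Q O a b = ∑ i, ∑ j, π i * Q i j * (O a i * O b j) := by
  simp only [momentFactorization, Matrix.mul_apply (M := O * (Matrix.diagonal π * Q)),
    Matrix.mul_apply (M := O), Matrix.diagonal_mul, Matrix.transpose_apply, Finset.sum_mul]
  rw [Finset.sum_comm]
  refine Finset.sum_congr rfl fun i _ => Finset.sum_congr rfl fun j _ => ?_
  ring

/-- If `O` is injective and `T` is invertible then `O T Oᵀ` has full rank. -/
theorem rank_mul_mul_transpose {M K : ℕ} (O : Matrix (Fin M) (Fin K) ℝ)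
    (T : Matrix (Fin K) (Fin K) ℝ) (hO : ∀ v, O.mulVec v = 0 → v = 0) (hT : IsUnit T) :
    (O * T * O.transpose).rank = K := by
  have hG : IsUnit (O.transpose * O) := by
    rw [← Matrix.mulVec_injective_iff_isUnit]
    refine (injective_iff_map_eq_zero (Matrix.mulVecLin (O.transpose * O))).2 fun v hv => hO v ?_
    rw [Matrix.mulVecLin_apply, ← Matrix.mulVec_mulVec] at hv
    have : dotProduct (O.mulVec v) (O.mulVec v) = 0 := by
      rw [Matrix.dotProduct_mulVec, ← Matrix.mulVec_transpose, hv, zero_dotProduct]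
    exact dotProduct_self_eq_zero.1 this
  refine le_antisymm ?_ ?_
  · calc (O * T * O.transpose).rank ≤ (O * T).rank := Matrix.rank_mul_le_left _ _
      _ ≤ K := by simpa using (O * T).rank_le_width
  · have h1 : ((O.transpose * O) * T * (O.transpose * O)).rank = K := by
      rw [Matrix.rank_of_isUnit _ ((hG.mul hT).mul hG), Fintype.card_fin]
    have h2 : (O.transpose * O) * T * (O.transpose * O)
        = O.transpose * (O * T * O.transpose) * O := by
      simp only [Matrix.mul_assoc]
    rw [h2] at h1
    calc K = _ := h1.symm
      _ ≤ (O.transpose * (O * T * O.transpose)).rank := Matrix.rank_mul_le_left _ _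
      _ ≤ _ := Matrix.rank_mul_le_right _ _

variable {𝒴 : Type*} [MeasurableSpace 𝒴] {μ : Measure 𝒴}

theorem emissionMatrix_eq_inner {M K : ℕ} (φ : Fin M → Lp ℝ 2 μ) (f : Fin K → Lp ℝ 2 μ)
    (a : Fin M) (k : Fin K) : emissionMatrix φ f a k = inner ℝ (φ a) (f k) := by
  rw [L2.inner_def]
  simp [emissionMatrix, mul_comm]

/-- For large `M`, the coordinates of a linearly independent family are linearly independent. -/
theorem exists_emissionMatrix_injective {ℳ : Set ℕ} {𝔓 : ℕ → Submodule ℝ (Lp ℝ 2 μ)}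
    (h𝔓 : IsApproximationFamily μ ℳ 𝔓) {Φ : (M : ℕ) → Fin M → Lp ℝ 2 μ}
    (hΦ : ∀ M ∈ ℳ, IsOrthonormalBasisOf (Φ M) (𝔓 M)) {K : ℕ} {f : Fin K → Lp ℝ 2 μ}
    (hf : LinearIndependent ℝ f) :
    ∃ M₀ ∈ ℳ, ∀ M ∈ ℳ, M₀ ≤ M → ∀ v, (emissionMatrix (Φ M) f).mulVec v = 0 → v = 0 := by
  -- Independence survives perturbations smaller than some `ε`; the plan is to move each `f k` by
  -- less than `ε` by projecting it onto `𝔓 M`.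
  have hopen := isOpen_setOfPred_linearIndependent (𝕜 := ℝ) (E := Lp ℝ 2 μ) (ι := Fin K)
  obtain ⟨ε, hε, hball⟩ := Metric.isOpen_iff.1 hopen f hf
  have happrox : ∀ k, ∃ M ∈ ℳ, ∃ g ∈ 𝔓 M, dist g (f k) < ε := by
    intro k
    obtain ⟨g, hg, hgd⟩ := h𝔓.dense.exists_dist_lt (f k) hε
    simp only [Set.mem_iUnion] at hg
    obtain ⟨M, hM, hgM⟩ := hg
    exact ⟨M, hM, g, hgM, by rwa [dist_comm]⟩
  choose m hm g hg hgd using happrox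
  obtain ⟨M₁, hM₁⟩ : ℳ.Nonempty := by
    obtain ⟨g, hg⟩ := h𝔓.dense.nonempty
    simp only [Set.mem_iUnion] at hg
    exact ⟨hg.choose, hg.choose_spec.choose⟩
  obtain ⟨M₀, hM₀, hle⟩ : ∃ M₀ ∈ ℳ, ∀ k, m k ≤ M₀ := by
    rcases isEmpty_or_nonempty (Fin K) with h | h
    · exact ⟨M₁, hM₁, fun k => h.elim k⟩
    · obtain ⟨k, hk⟩ := Finite.exists_max m
      exact ⟨m k, hm k, hk⟩
  refine ⟨M₀, hM₀, fun M hM hMM v hv => ?_⟩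
  have hfin : FiniteDimensional ℝ (𝔓 M) := by
    rw [← (hΦ M hM).span_eq]
    exact FiniteDimensional.span_of_finite ℝ (Set.finite_range _)
  have hpr : LinearIndependent ℝ fun k => (𝔓 M).starProjection (f k) := by
    refine hball ?_
    rw [Metric.mem_ball, dist_pi_lt_iff hε]
    intro k
    have hgk : g k ∈ 𝔓 M := h𝔓.nested _ (hm k) _ hM ((hle k).trans hMM) (hg k)
    have h1 : ‖f k - (𝔓 M).starProjection (f k)‖ ≤ ‖f k - g k‖ := by
      rw [(𝔓 M).starProjection_minimal]
      exact ciInf_le ⟨0, by rintro _ ⟨x, rfl⟩; exact norm_nonneg _⟩ (⟨g k, hgk⟩ : 𝔓 M)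
    rw [dist_comm, dist_eq_norm]
    refine h1.trans_lt ?_
    rw [← dist_eq_norm, dist_comm]
    exact hgd k
  -- `O v = 0` says that `∑ v k • f k` is orthogonal to every `φ a`, hence that its projection onto
  -- `𝔓 M` vanishes.
  have hz : ∑ k, v k • (𝔓 M).starProjection (f k) = 0 := by
    rw [← Finset.sum_congr rfl fun k _ => map_smul (𝔓 M).starProjection (v k) (f k), ← map_sum,
      Submodule.starProjection_apply_eq_zero_iff, ← (hΦ M hM).span_eq, Submodule.mem_orthogonal]
    intro u hu
    induction hu using Submodule.span_induction with
    | mem x hx =>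
      obtain ⟨a, rfl⟩ := hx
      have := congrFun hv a
      simp only [Matrix.mulVec, dotProduct, emissionMatrix_eq_inner, Pi.zero_apply] at this
      rw [inner_sum, ← this]
      exact Finset.sum_congr rfl fun k _ => by rw [real_inner_smul_right, mul_comm]
    | zero => simp
    | add x y _ _ hx hy => rw [inner_add_left, hx, hy, add_zero]
    | smul c x _ hx => rw [real_inner_smul_left, hx, mul_zero]
  ext k
  exact Fintype.linearIndependent_iff.1 hpr v hz k

end Rank

end SpectralHMM

namespace SpectralHMM

/-! ### Integration against the emission distributions. -/

section Emission

variable {𝒴 : Type*} [MeasurableSpace 𝒴] {μ : Measure 𝒴}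

theorem IsProbDensity.isProbabilityMeasure {f : Lp ℝ 2 μ} (hf : IsProbDensity f) :
    IsProbabilityMeasure (emission f) :=
  ⟨by rw [emission, withDensity_apply _ MeasurableSet.univ, Measure.restrict_univ,
    hf.lintegral_eq_one]⟩

theorem emission_absolutelyContinuous (f : Lp ℝ 2 μ) : emission f ≪ μ :=
  withDensity_absolutelyContinuous _ _

theorem measurable_ofReal_coe (f : Lp ℝ 2 μ) : Measurable fun y => ENNReal.ofReal (f y) :=
  (Lp.stronglyMeasurable f).measurable.ennreal_ofReal

/-- Integration against an emission distribution. -/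
theorem integral_emission {f : Lp ℝ 2 μ} (hf : IsProbDensity f) (φ : 𝒴 → ℝ) :
    ∫ y, φ y ∂emission f = ∫ y, φ y * f y ∂μ := by
  rw [emission, integral_withDensity_eq_integral_toReal_smul (measurable_ofReal_coe f)
    (ae_of_all _ fun _ => ENNReal.ofReal_lt_top)]
  refine integral_congr_ae ?_
  filter_upwards [hf.nonneg] with y hy
  simp [ENNReal.toReal_ofReal hy, mul_comm]

theorem integrable_emission {f : Lp ℝ 2 μ} (hf : IsProbDensity f) (φ : Lp ℝ 2 μ) :
    Integrable φ (emission f) := by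
  rw [emission, integrable_withDensity_iff_integrable_smul' (measurable_ofReal_coe f)
    (ae_of_all _ fun _ => ENNReal.ofReal_lt_top)]
  have h : Integrable (fun y => f y * φ y) μ :=
    MemLp.integrable_mul (Lp.memLp f) (Lp.memLp φ)
  refine h.congr ?_
  filter_upwards [hf.nonneg] with y hy
  simp [ENNReal.toReal_ofReal hy]

theorem emissionMatrix_eq_integral {M K : ℕ} {φ : Fin M → Lp ℝ 2 μ} {f : Fin K → Lp ℝ 2 μ}
    (hf : ∀ k, IsProbDensity (f k)) (a : Fin M) (k : Fin K) :
    emissionMatrix φ f a k = ∫ y, φ a y ∂emission (f k) := by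
  rw [integral_emission (hf k)]
  rfl

end Emission

/-! ### Laws of the observations and Markov property of the joint chain. -/

section HMM

variable {𝒴 : Type*} [MeasurableSpace 𝒴] {μ : Measure 𝒴} {K : ℕ}
  {Ω : Type*} [MeasurableSpace Ω] {P : Measure Ω} {π : Fin K → ℝ}
  {Q : Matrix (Fin K) (Fin K) ℝ} {f : Fin K → Lp ℝ 2 μ} {X : ℕ → Ω → Fin K} {Y : ℕ → Ω → 𝒴}

/-- The laws of the observations are absolutely continuous. -/
theorem IsHMM.map_absolutelyContinuous (h : IsHMM P π Q f X Y) (s : ℕ) : P.map (Y s) ≪ μ := by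
  refine Measure.AbsolutelyContinuous.mk fun A hA hμA => ?_
  rw [Measure.map_apply (h.measurable_obs s) hA]
  -- `condIndep` only evaluates events that fix the whole hidden path up to time `s`, so the event
  -- is split over the finitely many such paths, with the observation constrained at time `s` alone.
  have hsub : Y s ⁻¹' A ⊆ ⋃ x : Fin (s + 1) → Fin K,
      {ω | ∀ j ≤ s, X j ω = x (Fin.ofNat (s + 1) j) ∧
        Y j ω ∈ if j = s then A else Set.univ} := by
    intro ω hω
    refine Set.mem_iUnion.2 ⟨fun j => X j ω, fun j hj => ⟨?_, ?_⟩⟩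
    · beta_reduce
      rw [Fin.val_ofNat, Nat.mod_eq_of_lt (by omega)]
    · split_ifs with hjs
      · subst hjs; exact hω
      · trivial
  refine measure_mono_null hsub (measure_iUnion_null fun x => ?_)
  rw [h.condIndep s (fun j => x (Fin.ofNat (s + 1) j)) (fun j => if j = s then A else Set.univ)
    (fun j => by split_ifs <;> simp [hA])]
  refine mul_eq_zero_of_right _ (Finset.prod_eq_zero (Finset.self_mem_range_succ s) ?_)
  simpa using emission_absolutelyContinuous (f _) hμA

theorem IsHMM.prob_pair (h : IsHMM P π Q f X Y) (i j : Fin K) {A B : Set 𝒴}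
    (hA : MeasurableSet A) (hB : MeasurableSet B) :
    P {ω | (X 0 ω = i ∧ Y 0 ω ∈ A) ∧ X 1 ω = j ∧ Y 1 ω ∈ B} =
      ENNReal.ofReal (π i * Q i j) * (emission (f i) A * emission (f j) B) := by
  have h1 := h.condIndep 1 (fun s => if s = 0 then i else j) (fun s => if s = 0 then A else B)
    (fun s => by split_ifs <;> assumption)
  rw [h.markov] at h1
  simpa [Nat.le_one_iff_eq_zero_or_eq_one, Finset.prod_range_succ] using h1

/-- The law of the first two observations. -/
theorem IsHMM.map_pair [IsProbabilityMeasure P] (h : IsHMM P π Q f X Y)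
    (hf : ∀ k, IsProbDensity (f k)) :
    P.map (fun ω => (Y 0 ω, Y 1 ω)) = ∑ p : Fin K × Fin K,
      ENNReal.ofReal (π p.1 * Q p.1 p.2) • (emission (f p.1)).prod (emission (f p.2)) := by
  have := fun k => (hf k).isProbabilityMeasure
  have hm : Measurable fun ω => (Y 0 ω, Y 1 ω) :=
    (h.measurable_obs 0).prodMk (h.measurable_obs 1)
  have : IsFiniteMeasure (P.map fun ω => (Y 0 ω, Y 1 ω)) := inferInstance
  refine Measure.ext_prod fun {A B} hA hB => ?_
  rw [Measure.map_apply hm (hA.prod hB)]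
  have hpart : (fun ω => (Y 0 ω, Y 1 ω)) ⁻¹' A ×ˢ B = ⋃ p : Fin K × Fin K,
      {ω | (X 0 ω = p.1 ∧ Y 0 ω ∈ A) ∧ X 1 ω = p.2 ∧ Y 1 ω ∈ B} := by
    ext ω
    simp
  have hmeas : ∀ p : Fin K × Fin K,
      MeasurableSet {ω | (X 0 ω = p.1 ∧ Y 0 ω ∈ A) ∧ X 1 ω = p.2 ∧ Y 1 ω ∈ B} := fun p =>
    (((h.measurable_hidden 0) (measurableSet_singleton p.1)).inter (h.measurable_obs 0 hA)).inter
      (((h.measurable_hidden 1) (measurableSet_singleton p.2)).inter (h.measurable_obs 1 hB))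
  rw [hpart, measure_iUnion _ hmeas, tsum_fintype]
  · simp only [h.prob_pair _ _ hA hB, Measure.coe_finsetSum, Finset.sum_apply,
      Measure.smul_apply, Measure.prod_prod, smul_eq_mul]
  · intro p q hpq
    refine Set.disjoint_left.2 fun ω hp hq => hpq (Prod.ext ?_ ?_)
    · exact hp.1.1.symm.trans hq.1.1
    · exact hp.2.1.symm.trans hq.2.1

/-- The moment matrix factors through the coordinates of the emission densities. -/
theorem IsHMM.momentMatrix_eq [IsProbabilityMeasure P] (h : IsHMM P π Q f X Y)
    (hQ : Q ∈ Matrix.rowStochastic ℝ (Fin K)) (hπ : π ∈ stdSimplex ℝ (Fin K))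
    (hf : ∀ k, IsProbDensity (f k)) {M : ℕ} (φ : Fin M → Lp ℝ 2 μ) :
    momentMatrix P φ Y = momentFactorization π Q (emissionMatrix φ f) := by
  have := fun k => (hf k).isProbabilityMeasure
  have hm : Measurable fun ω => (Y 0 ω, Y 1 ω) :=
    (h.measurable_obs 0).prodMk (h.measurable_obs 1)
  ext a b
  have hmeas : StronglyMeasurable fun z : 𝒴 × 𝒴 => φ a z.1 * φ b z.2 :=
    ((Lp.stronglyMeasurable (φ a)).comp_measurable measurable_fst).mul
      ((Lp.stronglyMeasurable (φ b)).comp_measurable measurable_snd)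
  have h1 : momentMatrix P φ Y a b =
      ∫ z, φ a z.1 * φ b z.2 ∂P.map (fun ω => (Y 0 ω, Y 1 ω)) := by
    rw [integral_map hm.aemeasurable hmeas.aestronglyMeasurable]
    rfl
  rw [h1, h.map_pair hf, integral_finsetSum_measure, momentFactorization_apply,
    Fintype.sum_prod_type]
  · refine Finset.sum_congr rfl fun i _ => Finset.sum_congr rfl fun j _ => ?_
    rw [integral_smul_measure, integral_prod_mul,
      ENNReal.toReal_ofReal (mul_nonneg (hπ.1 i) (hQ.1 i j)), emissionMatrix_eq_integral hf,
      emissionMatrix_eq_integral hf, smul_eq_mul]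
  · intro p _
    exact Integrable.smul_measure
      (Integrable.mul_prod (integrable_emission (hf _) _) (integrable_emission (hf _) _))
      ENNReal.ofReal_ne_top

/-- The transition kernel of the joint chain `(X_j, Y_j)`, which depends on the hidden state
only. -/
noncomputable def stepKernel (Q : Matrix (Fin K) (Fin K) ℝ) (f : Fin K → Lp ℝ 2 μ) :
    ProbabilityTheory.Kernel (Fin K) (Fin K × 𝒴) :=
  ProbabilityTheory.Kernel.ofFunOfCountable fun i =>
    ∑ j, ENNReal.ofReal (Q i j) • (emission (f j)).map (Prod.mk j)

theorem stepKernel_apply (i : Fin K) : stepKernel Q f i =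
    ∑ j, ENNReal.ofReal (Q i j) • (emission (f j)).map (Prod.mk j) := rfl

theorem isMarkovKernel_stepKernel (hQ : Q ∈ Matrix.rowStochastic ℝ (Fin K))
    (hf : ∀ k, IsProbDensity (f k)) : ProbabilityTheory.IsMarkovKernel (stepKernel Q f) := by
  have := fun k => (hf k).isProbabilityMeasure
  refine ⟨fun i => ⟨?_⟩⟩
  have hone : ∑ j, Q i j = 1 := by
    simpa [Matrix.mulVec, dotProduct] using congrFun hQ.2 i
  rw [stepKernel_apply]
  simp only [Measure.coe_finsetSum, Finset.sum_apply, Measure.smul_apply, smul_eq_mul]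
  rw [← ENNReal.ofReal_one, ← hone, ENNReal.ofReal_sum_of_nonneg fun j _ => hQ.1 i j]
  refine Finset.sum_congr rfl fun j _ => ?_
  rw [Measure.map_apply measurable_prodMk_left MeasurableSet.univ]
  simp

theorem stepKernel_singleton_prod (i j : Fin K) {A : Set 𝒴} (hA : MeasurableSet A) :
    stepKernel Q f i ({j} ×ˢ A) = ENNReal.ofReal (Q i j) * emission (f j) A := by
  rw [stepKernel_apply]
  simp only [Measure.coe_finsetSum, Finset.sum_apply, Measure.smul_apply, smul_eq_mul]
  rw [Finset.sum_eq_single j]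
  · rw [Measure.map_apply measurable_prodMk_left ((measurableSet_singleton j).prod hA)]
    congr 2
    ext y
    simp
  · intro l _ hl
    rw [Measure.map_apply measurable_prodMk_left ((measurableSet_singleton j).prod hA)]
    have : Prod.mk l ⁻¹' ({j} ×ˢ A) = ∅ := by
      ext y
      simp [hl]
    simp [this]
  · simp

/-- Integration of a function against the transition kernel. -/
theorem integral_stepKernel (hQ : Q ∈ Matrix.rowStochastic ℝ (Fin K))
    (hf : ∀ k, IsProbDensity (f k)) {w : Fin K × 𝒴 → ℝ} (hw : Measurable w) {B : ℝ}
    (hB : ∀ v, |w v| ≤ B) (i : Fin K) :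
    ∫ v, w v ∂stepKernel Q f i = ∑ j, Q i j * ∫ y, w (j, y) ∂emission (f j) := by
  have := fun k => (hf k).isProbabilityMeasure
  rw [stepKernel_apply, integral_finsetSum_measure]
  · refine Finset.sum_congr rfl fun j _ => ?_
    rw [integral_smul_measure, integral_map measurable_prodMk_left.aemeasurable
      hw.aestronglyMeasurable, ENNReal.toReal_ofReal (hQ.1 i j), smul_eq_mul]
  · intro j _
    have : IsProbabilityMeasure ((emission (f j)).map (Prod.mk j)) :=
      Measure.isProbabilityMeasure_map measurable_prodMk_left.aemeasurable
    exact Integrable.smul_measure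
      (Integrable.of_bound hw.aestronglyMeasurable B (ae_of_all _ hB)) ENNReal.ofReal_ne_top

/-- The first `n + 1` states of the joint chain. -/
def jointPath (X : ℕ → Ω → Fin K) (Y : ℕ → Ω → 𝒴) (n : ℕ) (ω : Ω) : Fin (n + 1) → Fin K × 𝒴 :=
  fun j => (X j ω, Y j ω)

theorem IsHMM.measurable_jointPath (h : IsHMM P π Q f X Y) (n : ℕ) :
    Measurable (jointPath X Y n) :=
  measurable_pi_lambda _ fun j => (h.measurable_hidden j).prodMk (h.measurable_obs j)

variable (K 𝒴) in
/-- The cylinders `{i} × A`. -/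
def stateCylinders : Set (Set (Fin K × 𝒴)) :=
  {s | ∃ (i : Fin K) (A : Set 𝒴), MeasurableSet A ∧ s = {i} ×ˢ A}

/-- These cylinders, with the hidden state pinned to one value, are the events whose probabilities
the model prescribes. They generate the product σ-algebra because there are finitely many states. -/
theorem isPiSystem_stateCylinders : IsPiSystem (stateCylinders 𝒴 K) := by
  rintro _ ⟨i, A, hA, rfl⟩ _ ⟨j, B, hB, rfl⟩ ⟨v, hv⟩
  have hi : v.1 = i := hv.1.1
  have hj : v.1 = j := hv.2.1
  refine ⟨i, A ∩ B, hA.inter hB, ?_⟩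
  rw [Set.prod_inter_prod, ← hi, ← hj, Set.inter_self]

theorem isCountablySpanning_stateCylinders [Nonempty (Fin K)] :
    IsCountablySpanning (stateCylinders 𝒴 K) := by
  obtain ⟨e, he⟩ := exists_surjective_nat (Fin K)
  refine ⟨fun n => {e n} ×ˢ Set.univ, fun n => ⟨e n, Set.univ, MeasurableSet.univ, rfl⟩, ?_⟩
  ext v
  obtain ⟨n, hn⟩ := he v.1
  simp only [Set.mem_iUnion, Set.mem_univ, iff_true]
  exact ⟨n, by simp [hn]⟩

theorem generateFrom_stateCylinders :
    MeasurableSpace.generateFrom (stateCylinders 𝒴 K) = Prod.instMeasurableSpace := by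
  refine le_antisymm (MeasurableSpace.generateFrom_le ?_) ?_
  · rintro _ ⟨i, A, hA, rfl⟩
    exact (measurableSet_singleton i).prod hA
  · intro s hs
    have : s = ⋃ i : Fin K, {i} ×ˢ (Prod.mk i ⁻¹' s) := by
      ext ⟨i, y⟩
      simp
    rw [this]
    refine MeasurableSet.iUnion fun i => ?_
    exact MeasurableSpace.measurableSet_generateFrom ⟨i, _, measurable_prodMk_left hs, rfl⟩

/-- Probabilities of cylinders of the joint chain satisfy the Markov recursion. -/
theorem IsHMM.prob_succ (h : IsHMM P π Q f X Y) (hQ : Q ∈ Matrix.rowStochastic ℝ (Fin K))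
    (hπ : π ∈ stdSimplex ℝ (Fin K)) (n : ℕ) (x : ℕ → Fin K)
    (A : ℕ → Set 𝒴) (hA : ∀ j, MeasurableSet (A j)) :
    P {ω | ∀ j ≤ n + 1, X j ω = x j ∧ Y j ω ∈ A j} =
      P {ω | ∀ j ≤ n, X j ω = x j ∧ Y j ω ∈ A j} *
        (ENNReal.ofReal (Q (x n) (x (n + 1))) * emission (f (x (n + 1))) (A (n + 1))) := by
  rw [h.condIndep _ x A hA, h.condIndep _ x A hA, h.markov, h.markov,
    Finset.prod_range_succ _ (n + 1), Finset.prod_range_succ _ n, ← mul_assoc (π (x 0)),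
    ENNReal.ofReal_mul (mul_nonneg (hπ.1 _) (Finset.prod_nonneg fun j _ => hQ.1 _ _))]
  ring

/-- The Markov property of the joint chain. -/
theorem IsHMM.map_jointPath_succ [IsProbabilityMeasure P] (h : IsHMM P π Q f X Y)
    (hQ : Q ∈ Matrix.rowStochastic ℝ (Fin K)) (hπ : π ∈ stdSimplex ℝ (Fin K))
    (hf : ∀ k, IsProbDensity (f k)) (n : ℕ) :
    P.map (fun ω => (jointPath X Y n ω, (X (n + 1) ω, Y (n + 1) ω))) =
      (P.map (jointPath X Y n)).compProd ((stepKernel Q f).comap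
        (fun p : Fin (n + 1) → Fin K × 𝒴 => (p (Fin.last n)).1)
        (measurable_fst.comp (measurable_pi_apply _))) := by
  have := isMarkovKernel_stepKernel hQ hf
  have hpath := h.measurable_jointPath n
  have hstate : Measurable fun ω => (X (n + 1) ω, Y (n + 1) ω) :=
    (h.measurable_hidden _).prodMk (h.measurable_obs _)
  have : IsProbabilityMeasure (P.map (jointPath X Y n)) :=
    Measure.isProbabilityMeasure_map hpath.aemeasurable
  have : IsProbabilityMeasure
      (P.map (fun ω => (jointPath X Y n ω, (X (n + 1) ω, Y (n + 1) ω)))) :=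
    Measure.isProbabilityMeasure_map (hpath.prodMk hstate).aemeasurable
  have : Nonempty (Fin K) := by
    obtain ⟨ω⟩ := nonempty_of_isProbabilityMeasure P
    exact ⟨X 0 ω⟩
  have hspan : IsCountablySpanning
      (Set.univ.pi '' Set.univ.pi fun _ : Fin (n + 1) => stateCylinders 𝒴 K) :=
    IsCountablySpanning.pi fun _ => isCountablySpanning_stateCylinders
  have hgen : MeasurableSpace.generateFrom
      (Set.univ.pi '' Set.univ.pi fun _ : Fin (n + 1) => stateCylinders 𝒴 K) =
        MeasurableSpace.pi :=
    generateFrom_eq_pi (fun _ => generateFrom_stateCylinders)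
      fun _ => isCountablySpanning_stateCylinders
  -- Both sides are probability measures, so it suffices to compare them on products of state
  -- cylinders.
  refine ext_of_generate_finite _ (generateFrom_eq_prod hgen generateFrom_stateCylinders hspan
    isCountablySpanning_stateCylinders).symm
    ((IsPiSystem.pi fun _ => isPiSystem_stateCylinders).prod isPiSystem_stateCylinders) ?_
    (by simp)
  rintro _ ⟨_, ⟨S, hS, rfl⟩, _, ⟨x', A', hA', rfl⟩, rfl⟩
  choose x A hA hSA using fun j => hS j (Set.mem_univ j)
  have hSm : MeasurableSet (Set.univ.pi S) := MeasurableSet.univ_pi fun j => by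
    rw [hSA j]
    exact (measurableSet_singleton _).prod (hA j)
  have hTm : MeasurableSet (({x'} : Set (Fin K)) ×ˢ A') := (measurableSet_singleton _).prod hA'
  rw [Measure.map_apply (hpath.prodMk hstate) (hSm.prod hTm),
    Measure.compProd_apply_prod hSm hTm]
  -- A cylinder of paths fixes the last hidden state, so the kernel is constant on it and the
  -- integral is a product.
  have hconst : ∀ p ∈ Set.univ.pi S, ((stepKernel Q f).comap
        (fun p : Fin (n + 1) → Fin K × 𝒴 => (p (Fin.last n)).1)
        (measurable_fst.comp (measurable_pi_apply _))) p ({x'} ×ˢ A') =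
      ENNReal.ofReal (Q (x (Fin.last n)) x') * emission (f x') A' := by
    intro p hp
    have hp' := hp (Fin.last n) (Set.mem_univ _)
    rw [hSA] at hp'
    rw [ProbabilityTheory.Kernel.comap_apply, stepKernel_singleton_prod _ _ hA',
      show (p (Fin.last n)).1 = x (Fin.last n) from hp'.1]
  rw [setLIntegral_congr_fun hSm hconst, setLIntegral_const, Measure.map_apply hpath hSm]
  let xx : ℕ → Fin K := fun j => if hj : j < n + 1 then x ⟨j, hj⟩ else x'
  let AA : ℕ → Set 𝒴 := fun j => if hj : j < n + 1 then A ⟨j, hj⟩ else A'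
  have hAA : ∀ j, MeasurableSet (AA j) := fun j => by
    simp only [AA]
    split_ifs
    · exact hA _
    · exact hA'
  have hset : jointPath X Y n ⁻¹' Set.univ.pi S = {ω | ∀ j ≤ n, X j ω = xx j ∧ Y j ω ∈ AA j} := by
    ext ω
    simp only [Set.mem_preimage, Set.mem_univ_pi, Set.mem_ofPred_eq, hSA]
    constructor
    · intro hω j hj
      have := hω ⟨j, by omega⟩
      simpa [xx, AA, hj, jointPath] using this
    · intro hω j
      have := hω j (by omega)
      simpa [xx, AA, jointPath, Nat.le_of_lt_succ j.2] using this
  have hset' : (fun ω => (jointPath X Y n ω, (X (n + 1) ω, Y (n + 1) ω))) ⁻¹'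
      (Set.univ.pi S) ×ˢ ({x'} ×ˢ A') =
        {ω | ∀ j ≤ n + 1, X j ω = xx j ∧ Y j ω ∈ AA j} := by
    have : {ω | ∀ j ≤ n + 1, X j ω = xx j ∧ Y j ω ∈ AA j} =
        {ω | ∀ j ≤ n, X j ω = xx j ∧ Y j ω ∈ AA j} ∩
          {ω | X (n + 1) ω = x' ∧ Y (n + 1) ω ∈ A'} := by
      ext ω
      simp only [Set.mem_ofPred_eq, Set.mem_inter_iff]
      constructor
      · intro hω
        exact ⟨fun j hj => hω j (by omega), by simpa [xx, AA] using hω (n + 1) le_rfl⟩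
      · rintro ⟨h1, h2⟩ j hj
        rcases Nat.le_succ_iff.1 hj with hj | rfl
        · exact h1 j hj
        · simpa [xx, AA] using h2
    rw [this, ← hset]
    rfl
  rw [hset, hset', h.prob_succ hQ hπ n xx AA hAA, mul_comm]
  have e1 : xx n = x (Fin.last n) := by simp [xx, Fin.last]
  have e2 : xx (n + 1) = x' := by simp [xx]
  have e3 : AA (n + 1) = A' := by simp [AA]
  rw [e1, e2, e3]

end HMM

end SpectralHMM

namespace SpectralHMM

/-! ### Azuma–Hoeffding bounds through a martingale decomposition. -/

section Concentration

variable {𝒴 : Type*} [MeasurableSpace 𝒴] {μ : Measure 𝒴} {K : ℕ}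
  {Ω : Type*} [MeasurableSpace Ω] {P : Measure Ω} {π : Fin K → ℝ}
  {Q : Matrix (Fin K) (Fin K) ℝ} {f : Fin K → Lp ℝ 2 μ} {X : ℕ → Ω → Fin K} {Y : ℕ → Ω → 𝒴}

/-- Integration over a path and the following state. -/
theorem IsHMM.lintegral_jointPath_succ [IsProbabilityMeasure P] (h : IsHMM P π Q f X Y)
    (hQ : Q ∈ Matrix.rowStochastic ℝ (Fin K)) (hπ : π ∈ stdSimplex ℝ (Fin K))
    (hf : ∀ k, IsProbDensity (f k)) (n : ℕ)
    {F : (Fin (n + 1) → Fin K × 𝒴) × (Fin K × 𝒴) → ℝ≥0∞} (hF : Measurable F) :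
    ∫⁻ ω, F (jointPath X Y n ω, (X (n + 1) ω, Y (n + 1) ω)) ∂P =
      ∫⁻ ω, ∫⁻ v, F (jointPath X Y n ω, v) ∂stepKernel Q f (X n ω) ∂P := by
  have := isMarkovKernel_stepKernel hQ hf
  have hpath := h.measurable_jointPath n
  have hstate : Measurable fun ω => (X (n + 1) ω, Y (n + 1) ω) :=
    (h.measurable_hidden _).prodMk (h.measurable_obs _)
  have : IsProbabilityMeasure (P.map (jointPath X Y n)) :=
    Measure.isProbabilityMeasure_map hpath.aemeasurable
  rw [← lintegral_map hF (hpath.prodMk hstate), h.map_jointPath_succ hQ hπ hf n,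
    Measure.lintegral_compProd hF, lintegral_map hF.lintegral_kernel_prod_right' hpath]
  rfl

/-- Exponential moments of a sum of bounded conditionally centred functions of consecutive
states. -/
theorem IsHMM.lintegral_exp_sum_le [IsProbabilityMeasure P] (h : IsHMM P π Q f X Y)
    (hQ : Q ∈ Matrix.rowStochastic ℝ (Fin K)) (hπ : π ∈ stdSimplex ℝ (Fin K))
    (hf : ∀ k, IsProbDensity (f k)) {w : (Fin K × 𝒴) × (Fin K × 𝒴) → ℝ} (hw : Measurable w)
    {B : ℝ} (hB : ∀ z, |w z| ≤ B) (hc : ∀ v, ∫ v', w (v, v') ∂stepKernel Q f v.1 = 0)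
    (t : ℝ) (n : ℕ) :
    ∫⁻ ω, ENNReal.ofReal (Real.exp (t * ∑ s ∈ Finset.range n,
      w ((X s ω, Y s ω), (X (s + 1) ω, Y (s + 1) ω)))) ∂P ≤
      ENNReal.ofReal (Real.exp (n * (B ^ 2 * t ^ 2 / 2))) := by
  have := isMarkovKernel_stepKernel hQ hf
  -- Hoeffding's lemma for one conditional law: values in `[-B, B]` and mean zero give variance
  -- proxy `B ^ 2`.
  have hstep : ∀ v, ∫⁻ v', ENNReal.ofReal (Real.exp (t * w (v, v'))) ∂stepKernel Q f v.1 ≤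
      ENNReal.ofReal (Real.exp (B ^ 2 * t ^ 2 / 2)) := by
    intro v
    have hwv : Measurable fun v' => w (v, v') := hw.comp measurable_prodMk_left
    have hsg := ProbabilityTheory.hasSubgaussianMGF_of_mem_Icc_of_integral_eq_zero
      (μ := stepKernel Q f v.1) (X := fun v' => w (v, v')) (a := -B) (b := B) hwv.aemeasurable
      (ae_of_all _ fun v' => abs_le.1 (hB (v, v'))) (hc v)
    rw [← ofReal_integral_eq_lintegral_ofReal (hsg.integrable_exp_mul t)
      (ae_of_all _ fun _ => (Real.exp_pos _).le)]
    refine ENNReal.ofReal_le_ofReal ((hsg.mgf_le t).trans (le_of_eq ?_))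
    congr 3
    simp only [NNReal.coe_pow, NNReal.coe_div, coe_nnnorm, NNReal.coe_ofNat, Real.norm_eq_abs]
    rw [div_pow, sq_abs]
    ring
  -- Conditioning on the path up to time `n` factors out all but the last increment, whose
  -- exponential moment is bounded by `hstep`. Working in `ℝ≥0∞` avoids integrability side
  -- conditions.
  induction n with
  | zero => simp
  | succ n ih =>
    let F : (Fin (n + 1) → Fin K × 𝒴) → ℝ≥0∞ := fun p =>
      ENNReal.ofReal (Real.exp (t * ∑ s : Fin n, w (p s.castSucc, p s.succ)))
    have hF : Measurable F := by
      refine (Real.measurable_exp.comp (Measurable.const_mul ?_ t)).ennreal_ofReal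
      exact Finset.measurable_fun_sum _ fun s _ =>
        hw.comp ((measurable_pi_apply _).prodMk (measurable_pi_apply _))
    let G : (Fin (n + 1) → Fin K × 𝒴) × (Fin K × 𝒴) → ℝ≥0∞ := fun z =>
      F z.1 * ENNReal.ofReal (Real.exp (t * w (z.1 (Fin.last n), z.2)))
    have hGw : Measurable fun z : (Fin (n + 1) → Fin K × 𝒴) × (Fin K × 𝒴) =>
        ENNReal.ofReal (Real.exp (t * w (z.1 (Fin.last n), z.2))) :=
      (Real.measurable_exp.comp ((hw.comp (((measurable_pi_apply _).comp
        measurable_fst).prodMk measurable_snd)).const_mul t)).ennreal_ofReal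
    have hG : Measurable G := (hF.comp measurable_fst).mul hGw
    have hFω : ∀ ω, F (jointPath X Y n ω) = ENNReal.ofReal (Real.exp (t * ∑ s ∈ Finset.range n,
        w ((X s ω, Y s ω), (X (s + 1) ω, Y (s + 1) ω)))) := fun ω => by
      simp [F, jointPath, Finset.sum_range]
    have hGω : ∀ ω, ENNReal.ofReal (Real.exp (t * ∑ s ∈ Finset.range (n + 1),
        w ((X s ω, Y s ω), (X (s + 1) ω, Y (s + 1) ω)))) =
          G (jointPath X Y n ω, (X (n + 1) ω, Y (n + 1) ω)) := fun ω => by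
      simp only [G]
      rw [hFω, Finset.sum_range_succ, mul_add, Real.exp_add,
        ENNReal.ofReal_mul (Real.exp_pos _).le]
      simp [jointPath]
    simp only [hGω]
    rw [h.lintegral_jointPath_succ hQ hπ hf n hG]
    calc ∫⁻ ω, ∫⁻ v, G (jointPath X Y n ω, v) ∂stepKernel Q f (X n ω) ∂P
        ≤ ∫⁻ ω, F (jointPath X Y n ω) *
            ENNReal.ofReal (Real.exp (B ^ 2 * t ^ 2 / 2)) ∂P := by
          refine lintegral_mono fun ω => ?_
          have hGω : Measurable fun v => ENNReal.ofReal
              (Real.exp (t * w (jointPath X Y n ω (Fin.last n), v))) :=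
            hGw.comp (measurable_prodMk_left (x := jointPath X Y n ω))
          simp only [G]
          rw [lintegral_const_mul _ hGω]
          gcongr
          exact hstep (X n ω, Y n ω)
      _ = (∫⁻ ω, F (jointPath X Y n ω) ∂P) *
            ENNReal.ofReal (Real.exp (B ^ 2 * t ^ 2 / 2)) :=
          lintegral_mul_const _ (hF.comp (h.measurable_jointPath n))
      _ ≤ ENNReal.ofReal (Real.exp (n * (B ^ 2 * t ^ 2 / 2))) *
            ENNReal.ofReal (Real.exp (B ^ 2 * t ^ 2 / 2)) := by
          gcongr
          simpa only [hFω] using ih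
      _ = _ := by
          rw [← ENNReal.ofReal_mul (Real.exp_pos _).le, ← Real.exp_add]
          congr 2
          push_cast
          ring

/-- Repackages the exponential bound so that Chernoff's inequality applies; finiteness of the same
bound supplies the required integrability. -/
theorem IsHMM.hasSubgaussianMGF_sum [IsProbabilityMeasure P] (h : IsHMM P π Q f X Y)
    (hQ : Q ∈ Matrix.rowStochastic ℝ (Fin K)) (hπ : π ∈ stdSimplex ℝ (Fin K))
    (hf : ∀ k, IsProbDensity (f k)) {w : (Fin K × 𝒴) × (Fin K × 𝒴) → ℝ} (hw : Measurable w)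
    {B : ℝ} (hB : ∀ z, |w z| ≤ B) (hc : ∀ v, ∫ v', w (v, v') ∂stepKernel Q f v.1 = 0) (n : ℕ) :
    ProbabilityTheory.HasSubgaussianMGF (fun ω => ∑ s ∈ Finset.range n,
      w ((X s ω, Y s ω), (X (s + 1) ω, Y (s + 1) ω))) (n * ‖B‖₊ ^ 2) P := by
  have hm : Measurable fun ω => ∑ s ∈ Finset.range n,
      w ((X s ω, Y s ω), (X (s + 1) ω, Y (s + 1) ω)) :=
    Finset.measurable_fun_sum _ fun s _ => hw.comp
      (((h.measurable_hidden _).prodMk (h.measurable_obs _)).prodMk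
        ((h.measurable_hidden _).prodMk (h.measurable_obs _)))
  have hexp := h.lintegral_exp_sum_le hQ hπ hf hw hB hc
  have hint : ∀ t : ℝ, Integrable (fun ω => Real.exp (t * ∑ s ∈ Finset.range n,
      w ((X s ω, Y s ω), (X (s + 1) ω, Y (s + 1) ω)))) P := fun t => by
    refine ⟨(Real.measurable_exp.comp (hm.const_mul t)).aestronglyMeasurable, ?_⟩
    rw [hasFiniteIntegral_iff_ofReal (ae_of_all _ fun _ => (Real.exp_pos _).le)]
    exact (hexp t n).trans_lt ENNReal.ofReal_lt_top
  refine ⟨hint, fun t => ?_⟩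
  rw [ProbabilityTheory.mgf, integral_eq_lintegral_of_nonneg_ae
    (ae_of_all _ fun _ => (Real.exp_pos _).le) (hint t).aestronglyMeasurable]
  refine (ENNReal.toReal_mono ENNReal.ofReal_ne_top (hexp t n)).trans (le_of_eq ?_)
  rw [ENNReal.toReal_ofReal (Real.exp_pos _).le]
  congr 1
  simp
  ring

/-- Deviation inequality for the empirical moments of bounded functions. -/
theorem IsHMM.measureReal_abs_sum_ge_le [IsProbabilityMeasure P] (h : IsHMM P π Q f X Y)
    (hQ : Q ∈ Matrix.rowStochastic ℝ (Fin K)) (hπ : π ∈ stdSimplex ℝ (Fin K))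
    (hf : ∀ k, IsProbDensity (f k)) {L : ℝ} (hL : ∀ (h : Fin K → ℝ) (B : ℝ), (∀ i, |h i| ≤ B) →
      ∃ g : Fin K → ℝ, (∀ i, |g i| ≤ L * B) ∧
        ∀ i, g i - ∑ j, Q i j * g j = h i - ∑ j, π j * h j)
    {φ ψ : 𝒴 → ℝ} (hφ : Measurable φ) (hψ : Measurable ψ) {R : ℝ}
    (hφR : ∀ y, |φ y| ≤ R) (hψR : ∀ y, |ψ y| ≤ R) (n : ℕ) {ε : ℝ} (hε : 0 ≤ ε) :
    P.real {ω | ε + (6 + 2 * L) * R ^ 2 ≤ |∑ s ∈ Finset.range n, φ (Y s ω) * ψ (Y (s + 1) ω) -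
      n * ∑ i, ∑ j, π i * Q i j *
        ((∫ y, φ y ∂emission (f i)) * ∫ y, ψ y ∂emission (f j))|} ≤
      2 * Real.exp (-ε ^ 2 / (2 * (n * ((6 + 2 * L) * R ^ 2) ^ 2))) := by
  have := fun k => (hf k).isProbabilityMeasure
  have hmark := isMarkovKernel_stepKernel hQ hf
  set oφ : Fin K → ℝ := fun i => ∫ y, φ y ∂emission (f i) with hoφ
  set oψ : Fin K → ℝ := fun i => ∫ y, ψ y ∂emission (f i) with hoψ
  set qψ : Fin K → ℝ := fun i => ∑ j, Q i j * oψ j with hqψ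
  obtain ⟨y₀⟩ : Nonempty 𝒴 := by
    obtain ⟨ω⟩ := nonempty_of_isProbabilityMeasure P
    exact ⟨Y 0 ω⟩
  have hR : 0 ≤ R := (abs_nonneg _).trans (hφR y₀)
  have hQsum : ∀ i, ∑ j, Q i j = 1 := fun i => by
    simpa [Matrix.mulVec, dotProduct] using congrFun hQ.2 i
  have hint : ∀ {χ : 𝒴 → ℝ}, Measurable χ → (∀ y, |χ y| ≤ R) → ∀ i,
      Integrable χ (emission (f i)) := fun hχ hχR i =>
    Integrable.of_bound hχ.aestronglyMeasurable R (ae_of_all _ hχR)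
  have hoR : ∀ {χ : 𝒴 → ℝ}, (∀ y, |χ y| ≤ R) → ∀ i, |∫ y, χ y ∂emission (f i)| ≤ R :=
    fun {χ} hχR i => by
      have := norm_integral_le_of_norm_le_const (μ := emission (f i)) (f := χ) (C := R)
        (ae_of_all _ hχR)
      simpa using this
  have hqR : ∀ i, |qψ i| ≤ R := fun i => by
    calc |qψ i| ≤ ∑ j, |Q i j * oψ j| := Finset.abs_sum_le_sum_abs _ _
      _ ≤ ∑ j, Q i j * R := Finset.sum_le_sum fun j _ => by
          rw [abs_mul, abs_of_nonneg (hQ.1 i j)]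
          exact mul_le_mul_of_nonneg_left (hoR hψR j) (hQ.1 i j)
      _ = R := by rw [← Finset.sum_mul, hQsum, one_mul]
  have hmulR : ∀ {x y : ℝ}, |x| ≤ R → |y| ≤ R → |x * y| ≤ R ^ 2 := fun hx hy => by
    rw [abs_mul, sq]
    exact mul_le_mul hx hy (abs_nonneg _) hR
  set hh : Fin K → ℝ := fun i => oφ i * qψ i with hhh
  have hhR : ∀ i, |hh i| ≤ R ^ 2 := fun i => hmulR (hoR hφR i) (hqR i)
  obtain ⟨g, hgR, hg⟩ := hL hh (R ^ 2) hhR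
  set c : ℝ := ∑ i, ∑ j, π i * Q i j * (oφ i * oψ j) with hcdef
  have hc : c = ∑ j, π j * hh j := by
    refine Finset.sum_congr rfl fun i _ => ?_
    simp only [hhh, hqψ, Finset.mul_sum]
    exact Finset.sum_congr rfl fun j _ => by ring
  have hcR : |c| ≤ R ^ 2 := by
    rw [hc]
    calc |∑ j, π j * hh j| ≤ ∑ j, |π j * hh j| := Finset.abs_sum_le_sum_abs _ _
      _ ≤ ∑ j, π j * R ^ 2 := Finset.sum_le_sum fun j _ => by
          rw [abs_mul, abs_of_nonneg (hπ.1 j)]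
          exact mul_le_mul_of_nonneg_left (hhR j) (hπ.1 j)
      _ = R ^ 2 := by rw [← Finset.sum_mul, hπ.2, one_mul]
  -- `G` solves the Poisson equation of the joint chain with right-hand side `φ(y) qψ(x) - c`, the
  -- centred conditional mean of the summand. As `hh` is the emission average of `φ * qψ`, one step
  -- of the kernel sends `G` to `Q g`.
  let G : Fin K × 𝒴 → ℝ := fun v => φ v.2 * qψ v.1 + g v.1 - hh v.1
  have hGm : Measurable G :=
    (((hφ.comp measurable_snd).mul ((measurable_of_finite qψ).comp measurable_fst)).add
      ((measurable_of_finite g).comp measurable_fst)).sub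
      ((measurable_of_finite hh).comp measurable_fst)
  have hGR : ∀ v, |G v| ≤ (2 + L) * R ^ 2 := fun v => by
    have h1 := abs_le.1 (hmulR (hφR v.2) (hqR v.1))
    have h2 := abs_le.1 (hgR v.1)
    have h3 := abs_le.1 (hhR v.1)
    exact abs_le.2 ⟨by simp only [G]; linarith, by simp only [G]; linarith⟩
  let w : (Fin K × 𝒴) × (Fin K × 𝒴) → ℝ := fun z =>
    φ z.1.2 * ψ z.2.2 - c + G z.2 - G z.1
  have hwm : Measurable w :=
    ((((hφ.comp (measurable_snd.comp measurable_fst)).mul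
      (hψ.comp (measurable_snd.comp measurable_snd))).sub_const c).add
      (hGm.comp measurable_snd)).sub (hGm.comp measurable_fst)
  -- At most `R ^ 2` each from the product and from `c`, and `(2 + L) * R ^ 2` from each of the two
  -- values of `G`.
  set B := (6 + 2 * L) * R ^ 2 with hBdef
  have hwB : ∀ z, |w z| ≤ B := fun z => by
    have h1 := abs_le.1 (hmulR (hφR z.1.2) (hψR z.2.2))
    have h2 := abs_le.1 hcR
    have h3 := abs_le.1 (hGR z.1)
    have h4 := abs_le.1 (hGR z.2)
    exact abs_le.2 ⟨by simp only [w, hBdef]; linarith, by simp only [w, hBdef]; linarith⟩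
  have hcent : ∀ v, ∫ v', w (v, v') ∂stepKernel Q f v.1 = 0 := fun v => by
    have hwv : Measurable fun v' => w (v, v') := hwm.comp measurable_prodMk_left
    rw [integral_stepKernel hQ hf hwv (fun v' => hwB (v, v'))]
    have hj : ∀ j, ∫ y, w (v, (j, y)) ∂emission (f j) =
        φ v.2 * oψ j - c + (oφ j * qψ j + g j - hh j) - G v := fun j => by
      have i1 : Integrable (fun y => φ v.2 * ψ y) (emission (f j)) :=
        (hint hψ hψR j).const_mul _
      have i2 : Integrable (fun y => φ y * qψ j) (emission (f j)) :=
        (hint hφ hφR j).mul_const _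
      have : ∀ y, w (v, (j, y)) = φ v.2 * ψ y + φ y * qψ j + (-c + g j - hh j - G v) :=
        fun y => by simp only [w, G]; ring
      simp only [this]
      have i3 : Integrable (fun y => φ v.2 * ψ y + φ y * qψ j) (emission (f j)) := i1.add i2
      rw [integral_add i3 (integrable_const _), integral_add i1 i2,
        integral_const_mul, integral_mul_const, integral_const]
      simp only [probReal_univ, one_smul]
      ring
    simp only [hj]
    have e1 : ∑ j, Q v.1 j * (φ v.2 * oψ j - c + (oφ j * qψ j + g j - hh j) - G v) =
        φ v.2 * qψ v.1 + ∑ j, Q v.1 j * g j - (c + G v) * ∑ j, Q v.1 j := by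
      rw [show qψ v.1 = ∑ j, Q v.1 j * oψ j from rfl, Finset.mul_sum, Finset.mul_sum,
        ← Finset.sum_add_distrib, ← Finset.sum_sub_distrib]
      exact Finset.sum_congr rfl fun j _ => by simp only [hhh]; ring
    have e2 := hg v.1
    rw [← hc] at e2
    rw [hQsum] at e1
    rw [e1]
    simp only [G]
    linarith
  have hsg := h.hasSubgaussianMGF_sum hQ hπ hf hwm hwB hcent n
  -- The corrections by `G` telescope. The boundary term is at most `(4 + 2 * L) * R ^ 2 ≤ B`, which
  -- is why the deviation event is shifted by `B`.
  have htel : ∀ ω, ∑ s ∈ Finset.range n, φ (Y s ω) * ψ (Y (s + 1) ω) - n * c =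
      ∑ s ∈ Finset.range n, w ((X s ω, Y s ω), (X (s + 1) ω, Y (s + 1) ω)) +
        (G (X 0 ω, Y 0 ω) - G (X n ω, Y n ω)) := fun ω => by
    have h1 := Finset.sum_range_sub (fun s => G (X s ω, Y s ω)) n
    have h2 : ∑ s ∈ Finset.range n, w ((X s ω, Y s ω), (X (s + 1) ω, Y (s + 1) ω)) =
        ∑ s ∈ Finset.range n, φ (Y s ω) * ψ (Y (s + 1) ω) - n * c +
          ∑ s ∈ Finset.range n, (G (X (s + 1) ω, Y (s + 1) ω) - G (X s ω, Y s ω)) := by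
      have : (n : ℝ) * c = ∑ s ∈ Finset.range n, c := by simp
      rw [this, ← Finset.sum_sub_distrib, ← Finset.sum_add_distrib]
      exact Finset.sum_congr rfl fun s _ => by simp only [w]; ring
    rw [h2, h1]
    ring
  have hcoe : (((n : NNReal) * ‖B‖₊ ^ 2 : NNReal) : ℝ) = n * B ^ 2 := by simp
  have hup := hsg.measure_ge_le hε
  have hlo := hsg.neg.measure_ge_le hε
  rw [hcoe] at hup hlo
  refine (measureReal_mono ?_ (measure_ne_top _ _)).trans
    ((measureReal_union_le _ _).trans ((add_le_add hup hlo).trans (le_of_eq (two_mul _).symm)))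
  intro ω hω
  rw [Set.mem_ofPred_eq, htel ω] at hω
  have h1 := abs_le.1 (hGR (X 0 ω, Y 0 ω))
  have h2 := abs_le.1 (hGR (X n ω, Y n ω))
  have hR2 := sq_nonneg R
  rcases le_abs.1 hω with hω | hω
  · refine Or.inl ?_
    rw [Set.mem_ofPred_eq]
    linarith
  · refine Or.inr ?_
    rw [Set.mem_ofPred_eq, Pi.neg_apply]
    linarith

end Concentration

end SpectralHMM

namespace SpectralHMM

/-! ### Deviation of the empirical matrix, choice of constants, almost sure convergence. -/

section Estimator

variable {𝒴 : Type*} [MeasurableSpace 𝒴] {μ : Measure 𝒴} {K : ℕ}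
  {Ω : Type*} [MeasurableSpace Ω] {P : Measure Ω} {π : Fin K → ℝ}
  {Q : Matrix (Fin K) (Fin K) ℝ} {f : Fin K → Lp ℝ 2 μ} {X : ℕ → Ω → Fin K} {Y : ℕ → Ω → 𝒴}

/-- A bound for the essential suprema of the functions `φ a`. -/
noncomputable def supBound {M : ℕ} (φ : Fin M → Lp ℝ 2 μ) : ℝ :=
  1 + ∑ a, (eLpNorm (φ a) ∞ μ).toReal

theorem one_le_supBound {M : ℕ} (φ : Fin M → Lp ℝ 2 μ) : 1 ≤ supBound φ :=
  le_add_of_nonneg_right (Finset.sum_nonneg fun _ _ => ENNReal.toReal_nonneg)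

theorem ae_abs_le_supBound {M : ℕ} {φ : Fin M → Lp ℝ 2 μ} (hφ : ∀ a, MemLp (φ a) ∞ μ)
    (a : Fin M) : ∀ᵐ y ∂μ, |φ a y| ≤ supBound φ := by
  filter_upwards [ae_le_eLpNormEssSup (f := φ a) (μ := μ)] with y hy
  rw [← eLpNorm_exponent_top] at hy
  have h1 := ENNReal.toReal_mono (hφ a).2.ne hy
  rw [toReal_enorm, Real.norm_eq_abs] at h1
  have h2 := Finset.single_le_sum (f := fun a => (eLpNorm (φ a) ∞ μ).toReal)
    (fun _ _ => ENNReal.toReal_nonneg) (Finset.mem_univ a)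
  rw [supBound]
  linarith

/-- Truncation of a function at level `R`. -/
noncomputable def truncate {α : Type*} (R : ℝ) (φ : α → ℝ) (y : α) : ℝ := max (-R) (min R (φ y))

theorem measurable_truncate (R : ℝ) {φ : 𝒴 → ℝ} (hφ : Measurable φ) :
    Measurable (truncate R φ) :=
  measurable_const.max (measurable_const.min hφ)

theorem abs_truncate_le {α : Type*} {R : ℝ} (hR : 0 ≤ R) (φ : α → ℝ) (y : α) :
    |truncate R φ y| ≤ R :=
  abs_le.2 ⟨le_max_left _ _, max_le (by linarith) (min_le_left _ _)⟩

theorem truncate_eq_self {α : Type*} {R : ℝ} {φ : α → ℝ} {y : α} (h : |φ y| ≤ R) :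
    truncate R φ y = φ y := by
  rw [truncate, min_eq_right (abs_le.1 h).2, max_eq_right (abs_le.1 h).1]

/-- Deviation inequality for the entries of the empirical matrix. -/
theorem IsHMM.measureReal_entry_deviation_le [IsProbabilityMeasure P] (h : IsHMM P π Q f X Y)
    (hQ : Q ∈ Matrix.rowStochastic ℝ (Fin K)) (hπ : π ∈ stdSimplex ℝ (Fin K))
    (hf : ∀ k, IsProbDensity (f k)) {L : ℝ} (hL : ∀ (h : Fin K → ℝ) (B : ℝ), (∀ i, |h i| ≤ B) →
      ∃ g : Fin K → ℝ, (∀ i, |g i| ≤ L * B) ∧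
        ∀ i, g i - ∑ j, Q i j * g j = h i - ∑ j, π j * h j)
    {M : ℕ} {φ : Fin M → Lp ℝ 2 μ} (hφ : ∀ a, MemLp (φ a) ∞ μ) (a b : Fin M) (n : ℕ) {ε : ℝ}
    (hε : 0 ≤ ε) :
    P.real {ω | ε + (6 + 2 * L) * supBound φ ^ 2 ≤
      |∑ s ∈ Finset.range n, φ a (Y s ω) * φ b (Y (s + 1) ω) - n * momentMatrix P φ Y a b|} ≤
      2 * Real.exp (-ε ^ 2 / (2 * (n * ((6 + 2 * L) * supBound φ ^ 2) ^ 2))) := by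
  have hR : 0 ≤ supBound φ := zero_le_one.trans (one_le_supBound φ)
  -- The concentration bound needs pointwise bounded functions, while `φ a` is bounded only almost
  -- everywhere. Truncation changes neither the emission integrals nor, almost surely, the observed
  -- values.
  have hae : ∀ a, truncate (supBound φ) (φ a) =ᵐ[μ] φ a := fun a => by
    filter_upwards [ae_abs_le_supBound hφ a] with y hy using truncate_eq_self hy
  have hint : ∀ a k, emissionMatrix φ f a k =
      ∫ y, truncate (supBound φ) (φ a) y ∂emission (f k) := fun a k => by
    rw [emissionMatrix_eq_integral hf]
    exact integral_congr_ae ((emission_absolutelyContinuous (f k)).ae_eq (hae a)).symm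
  have hY : ∀ a, ∀ᵐ ω ∂P, ∀ s, truncate (supBound φ) (φ a) (Y s ω) = φ a (Y s ω) := fun a => by
    refine ae_all_iff.2 fun s => ?_
    exact ae_of_ae_map (h.measurable_obs s).aemeasurable
      ((h.map_absolutelyContinuous s).ae_eq (hae a))
  have hmain := h.measureReal_abs_sum_ge_le hQ hπ hf hL
    (measurable_truncate (supBound φ) (Lp.stronglyMeasurable (φ a)).measurable)
    (measurable_truncate (supBound φ) (Lp.stronglyMeasurable (φ b)).measurable)
    (abs_truncate_le hR _) (abs_truncate_le hR _) n hε
  simp only [← hint] at hmain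
  rw [← momentFactorization_apply, ← h.momentMatrix_eq hQ hπ hf φ] at hmain
  refine le_of_eq_of_le (measureReal_congr ?_) hmain
  filter_upwards [hY a, hY b] with ω ha hb
  refine propext (iff_of_eq ?_)
  change (_ ≤ _) = (_ ≤ _)
  simp only [ha, hb]

/-- Uniform deviation inequality for the empirical matrix. -/
theorem IsHMM.measureReal_exists_deviation_le [IsProbabilityMeasure P] (h : IsHMM P π Q f X Y)
    (hQ : Q ∈ Matrix.rowStochastic ℝ (Fin K)) (hπ : π ∈ stdSimplex ℝ (Fin K))
    (hf : ∀ k, IsProbDensity (f k)) {L : ℝ} (hL0 : 0 ≤ L)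
    (hL : ∀ (h : Fin K → ℝ) (B : ℝ), (∀ i, |h i| ≤ B) →
      ∃ g : Fin K → ℝ, (∀ i, |g i| ≤ L * B) ∧
        ∀ i, g i - ∑ j, Q i j * g j = h i - ∑ j, π j * h j)
    {M : ℕ} {φ : Fin M → Lp ℝ 2 μ} (hφ : ∀ a, MemLp (φ a) ∞ μ) {C : ℝ}
    (hC : 7 * ((M : ℝ) + 1) ^ 2 * ((6 + 2 * L) * supBound φ ^ 2) ≤ C) {n : ℕ} (hn : 2 ≤ n) :
    P.real {ω | ∃ a b, C * Real.sqrt (Real.log n / n) / (M + 1) <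
      |empiricalMatrix φ n (fun s => Y s ω) a b - momentMatrix P φ Y a b|} ≤
      1 / (n : ℝ) ^ 2 := by
  set B := (6 + 2 * L) * supBound φ ^ 2 with hB
  have hB1 : 1 ≤ B := by
    have := one_le_supBound φ
    nlinarith [one_le_pow₀ (n := 2) this]
  -- `M + 1` in place of `M` ensures `1 ≤ m` even for `M = 0`.
  set m : ℝ := (M : ℝ) + 1 with hm
  have hm1 : 1 ≤ m := by simp [hm]
  have hn2 : (2 : ℝ) ≤ n := by exact_mod_cast hn
  have hn0 : (0 : ℝ) < n := by linarith
  have hlog : 1 / 2 ≤ Real.log n := by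
    have := Real.log_le_log (by norm_num) hn2
    have := Real.log_two_gt_d9
    linarith
  have hC0 : 0 < C := lt_of_lt_of_le (by positivity) hC
  set r := Real.sqrt (Real.log n / n) with hr
  have hr2 : r ^ 2 = Real.log n / n := Real.sq_sqrt (by positivity)
  have hr0 : 0 ≤ r := Real.sqrt_nonneg _
  have hnr : 1 ≤ n * r := by
    have : 1 ≤ (n * r) ^ 2 := by
      rw [mul_pow, hr2]
      field_simp
      nlinarith
    exact (one_le_sq_iff₀ (by positivity)).1 this
  -- Half of the allowed deviation; the other half absorbs the boundary term `B`, because `n * r =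
  -- √(n log n) ≥ 1`.
  set ε := n * (C * r) / (2 * m) with hε
  have hε0 : 0 ≤ ε := by positivity
  have hεB : ε + B ≤ n * (C * r / m) := by
    have h1 : B ≤ ε := by
      rw [hε, le_div_iff₀ (by positivity)]
      have h2 : B * (2 * m) ≤ C := by nlinarith [mul_pos (by linarith : 0 < B) (by linarith : 0 < m)]
      nlinarith
    have h2 : n * (C * r / m) = ε + ε := by rw [hε]; field_simp; ring
    linarith
  -- The constant 7 in the condition on `C` comes from here: `C ≥ 7 m² B` gives `C² / (8 m² B²) ≥ 49
  -- m² / 8 ≥ 6 m²`.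
  have hexp : -ε ^ 2 / (2 * (n * B ^ 2)) ≤ -(6 * m ^ 2 * Real.log n) := by
    have h1 : ε ^ 2 / (2 * (n * B ^ 2)) = (C ^ 2 / (8 * m ^ 2 * B ^ 2)) * Real.log n := by
      rw [hε, div_pow, mul_pow, mul_pow C, hr2]
      field_simp
      ring
    have h2 : 6 * m ^ 2 ≤ C ^ 2 / (8 * m ^ 2 * B ^ 2) := by
      rw [le_div_iff₀ (by positivity)]
      calc 6 * m ^ 2 * (8 * m ^ 2 * B ^ 2) ≤ (7 * m ^ 2 * B) ^ 2 := by
            have : 0 ≤ (m ^ 2 * B) ^ 2 := by positivity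
            nlinarith
        _ ≤ C ^ 2 := by gcongr
    rw [neg_div, h1]
    exact neg_le_neg (mul_le_mul_of_nonneg_right h2 (by linarith))
  have hentry : ∀ p : Fin M × Fin M, P.real {ω | C * r / m <
      |empiricalMatrix φ n (fun s => Y s ω) p.1 p.2 - momentMatrix P φ Y p.1 p.2|} ≤
        2 * Real.exp (-(6 * m ^ 2 * Real.log n)) := fun p => by
    refine (measureReal_mono ?_ (measure_ne_top _ _)).trans
      ((h.measureReal_entry_deviation_le hQ hπ hf hL hφ p.1 p.2 n hε0).trans
        (mul_le_mul_of_nonneg_left (Real.exp_le_exp.2 hexp) zero_le_two))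
    intro ω hω
    rw [Set.mem_ofPred_eq] at hω ⊢
    refine hεB.trans ((mul_le_mul_of_nonneg_left hω.le hn0.le).trans (le_of_eq ?_))
    rw [← abs_of_pos hn0, ← abs_mul, abs_of_pos hn0]
    congr 1
    simp only [empiricalMatrix, Matrix.of_apply]
    field_simp
  have hcover : {ω | ∃ a b, C * r / m <
      |empiricalMatrix φ n (fun s => Y s ω) a b - momentMatrix P φ Y a b|} =
      ⋃ p : Fin M × Fin M, {ω | C * r / m <
        |empiricalMatrix φ n (fun s => Y s ω) p.1 p.2 - momentMatrix P φ Y p.1 p.2|} := by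
    ext ω
    simp
  rw [hcover]
  calc _ ≤ ∑ p : Fin M × Fin M, P.real {ω | C * r / m <
        |empiricalMatrix φ n (fun s => Y s ω) p.1 p.2 - momentMatrix P φ Y p.1 p.2|} :=
        measureReal_iUnion_fintype_le _
    _ ≤ ∑ _p : Fin M × Fin M, 2 * Real.exp (-(6 * m ^ 2 * Real.log n)) :=
        Finset.sum_le_sum fun p _ => hentry p
    _ = (M : ℝ) ^ 2 * 2 * Real.exp (-(6 * m ^ 2 * Real.log n)) := by
        simp; ring
    -- The union bound costs `2 M²`, which `exp (4 m² log n)` dominates as `log n ≥ 1/2`; a factor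
    -- `exp (-2 m² log n) ≤ n⁻²` remains.
    _ ≤ Real.exp (4 * m ^ 2 * Real.log n) * Real.exp (-(6 * m ^ 2 * Real.log n)) := by
        gcongr
        have h1 : (M : ℝ) ^ 2 ≤ m ^ 2 := by gcongr; simp [hm]
        have h2 := Real.add_one_le_exp (4 * m ^ 2 * Real.log n)
        have h3 : 0 ≤ m ^ 2 := by positivity
        nlinarith
    _ ≤ Real.exp (-(2 * Real.log n)) := by
        rw [← Real.exp_add]
        refine Real.exp_le_exp.2 ?_
        have h1 : 1 ≤ m ^ 2 := one_le_pow₀ hm1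
        nlinarith
    _ = 1 / (n : ℝ) ^ 2 := by
        rw [Real.exp_neg, two_mul, Real.exp_add, Real.exp_log hn0, one_div, sq]

/-- For large `n`, the threshold `C √(log n / n)` is smaller than half a given margin. -/
theorem exists_two_mul_threshold_lt {s : ℝ} (hs : 0 < s) :
    ∃ n₀ : ℝ, 3 ≤ n₀ ∧ ∀ (C : ℝ) (n : ℕ), 1 ≤ C → n₀ * C ^ 2 * (1 + Real.log C) ≤ n →
      2 * (C * Real.sqrt (Real.log n / n)) < s := by
  have hlim : Tendsto (fun x : ℝ => (Real.log x + 3) / x) atTop (𝓝 0) := by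
    have h1 : Tendsto (fun x : ℝ => Real.log x / x) atTop (𝓝 0) :=
      Real.isLittleO_log_id_atTop.tendsto_div_nhds_zero
    have h2 : Tendsto (fun x : ℝ => 3 / x) atTop (𝓝 0) := tendsto_const_nhds.div_atTop tendsto_id
    simpa [add_div] using h1.add h2
  -- Besides making the ratio small, `n₀ ≥ 3 > e` keeps every argument where `log x / x` is
  -- decreasing.
  obtain ⟨n₀, hn₀, hn₃⟩ := ((hlim.eventually_lt_const (by positivity : 0 < s ^ 2 / 4)).and
    (eventually_ge_atTop 3)).exists
  refine ⟨n₀, hn₃, fun C n hC hn => ?_⟩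
  have hlogC : 0 ≤ Real.log C := Real.log_nonneg hC
  set x := n₀ * C ^ 2 * (1 + Real.log C) with hx
  have hC2 : 1 ≤ C ^ 2 := one_le_pow₀ hC
  have hx3 : 3 ≤ x := by
    calc (3 : ℝ) ≤ n₀ * 1 * (1 + 0) := by linarith
      _ ≤ x := by rw [hx]; gcongr
  have hexp : Real.exp 1 ≤ 3 := by
    have := Real.exp_one_lt_d9
    linarith
  have hanti : Real.log n / n ≤ Real.log x / x :=
    Real.log_div_self_antitoneOn (Set.mem_Ici.2 (hexp.trans hx3))
      (Set.mem_Ici.2 (hexp.trans (hx3.trans hn))) hn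
  -- Here `log x = log n₀ + 2 log C + log (1 + log C)` and the last term is at most `log C`, whence
  -- the 3. The factor `C ^ 2 * (1 + log C)` in `x` then cancels all dependence on `C`.
  have hlogx : Real.log x ≤ (Real.log n₀ + 3) * (1 + Real.log C) := by
    rw [hx, Real.log_mul (by positivity) (by positivity), Real.log_mul (by positivity)
      (by positivity), Real.log_pow]
    have h1 : Real.log (1 + Real.log C) ≤ Real.log C := by
      have := Real.log_le_sub_one_of_pos (by positivity : 0 < 1 + Real.log C)
      linarith
    have h2 : 0 ≤ Real.log n₀ := Real.log_nonneg (by linarith)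
    push_cast
    nlinarith [mul_nonneg h2 hlogC]
  have hbound : C ^ 2 * (Real.log n / n) < s ^ 2 / 4 := by
    calc C ^ 2 * (Real.log n / n) ≤ C ^ 2 * (Real.log x / x) := by gcongr
      _ ≤ C ^ 2 * ((Real.log n₀ + 3) * (1 + Real.log C) / x) := by gcongr
      _ = (Real.log n₀ + 3) / n₀ := by rw [hx]; field_simp
      _ < s ^ 2 / 4 := hn₀
  refine lt_of_pow_lt_pow_left₀ 2 hs.le ?_
  rw [mul_pow, mul_pow, Real.sq_sqrt (div_nonneg (Real.log_natCast_nonneg n) n.cast_nonneg)]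
  linarith

/-- If the error probabilities of an estimator are eventually bounded by `n⁻²`, then it is
strongly consistent. -/
theorem ae_tendsto_of_measureReal_ne_le [IsFiniteMeasure P] {k : ℕ → Ω → ℕ} {k₀ n₁ : ℕ}
    (h : ∀ n, n₁ ≤ n → P.real {ω | k n ω ≠ k₀} ≤ 1 / (n : ℝ) ^ 2) :
    ∀ᵐ ω ∂P, Tendsto (fun n => k n ω) atTop (𝓝 k₀) := by
  -- Emptying the events before `n₁` makes the bound hold for all `n`, so Borel–Cantelli applies
  -- without a shift.
  have hle : ∀ n, P {ω | n₁ ≤ n ∧ k n ω ≠ k₀} ≤ ENNReal.ofReal (1 / (n : ℝ) ^ 2) := fun n => by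
    by_cases hn : n₁ ≤ n
    · simp only [hn, true_and]
      rw [← ofReal_measureReal (measure_ne_top _ _)]
      exact ENNReal.ofReal_le_ofReal (h n hn)
    · simp [hn]
  have hsum : ∑' n, P {ω | n₁ ≤ n ∧ k n ω ≠ k₀} ≠ ∞ := by
    refine ne_top_of_le_ne_top ?_ (ENNReal.tsum_le_tsum hle)
    rw [← ENNReal.ofReal_tsum_of_nonneg (fun n => by positivity)
      (Real.summable_one_div_nat_pow.2 one_lt_two)]
    exact ENNReal.ofReal_ne_top
  filter_upwards [ae_eventually_notMem hsum] with ω hω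
  refine tendsto_const_nhds.congr' ?_
  filter_upwards [hω, eventually_ge_atTop n₁] with n hn hn₁
  by_contra hne
  exact hn ⟨hn₁, fun h => hne h.symm⟩

end Estimator

end SpectralHMM

/-! ### Assembly of the main theorem. -/

/-- The constants `C₀ M φ` and `n₀ M φ O` are functions of the transition matrix, the orthonormal
basis `φ` of the `M`-th subspace and, for `n₀`, the matrix `O` of coordinates of the emission
densities. -/
theorem mainTheorem2 {𝒴 : Type*} [MeasurableSpace 𝒴] (μ : Measure 𝒴) [SigmaFinite μ]
    {K : ℕ} (Q : Matrix (Fin K) (Fin K) ℝ)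
    (hQ : Q ∈ Matrix.rowStochastic ℝ (Fin K)) (hQirr : Q.IsIrreducible) (hQinv : IsUnit Q) :
    ∃ C₀ : (M : ℕ) → (Fin M → Lp ℝ 2 μ) → ℝ,
    ∃ n₀ : (M : ℕ) → (Fin M → Lp ℝ 2 μ) → Matrix (Fin M) (Fin K) ℝ → ℝ,
      (∀ M φ, 0 < C₀ M φ) ∧ (∀ M φ O, 0 < n₀ M φ O) ∧
      ∀ (ℳ : Set ℕ) (𝔓 : ℕ → Submodule ℝ (Lp ℝ 2 μ)),
        SpectralHMM.IsApproximationFamily μ ℳ 𝔓 →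
      ∀ Φ : (M : ℕ) → Fin M → Lp ℝ 2 μ,
        (∀ M ∈ ℳ, SpectralHMM.IsOrthonormalBasisOf (Φ M) (𝔓 M)) →
      ∀ f : Fin K → Lp ℝ 2 μ,
        (∀ k, SpectralHMM.IsProbDensity (f k)) → LinearIndependent ℝ f →
      -- there is a threshold in `ℳ` beyond which the moment matrix has rank `K`
      (∃ M₀ ∈ ℳ, ∀ (Ω : Type*) [MeasurableSpace Ω] (P : Measure Ω) [IsProbabilityMeasure P]
          (π : Fin K → ℝ) (X : ℕ → Ω → Fin K) (Y : ℕ → Ω → 𝒴),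
          π ∈ stdSimplex ℝ (Fin K) → Matrix.vecMul π Q = π →
          SpectralHMM.IsHMM P π Q f X Y →
          ∀ M ∈ ℳ, M₀ ≤ M → (SpectralHMM.momentMatrix P (Φ M) Y).rank = K) ∧
      -- for every such threshold, the estimator is consistent
      (∀ (Ω : Type*) [MeasurableSpace Ω] (P : Measure Ω) [IsProbabilityMeasure P]
          (π : Fin K → ℝ) (X : ℕ → Ω → Fin K) (Y : ℕ → Ω → 𝒴),
          π ∈ stdSimplex ℝ (Fin K) → Matrix.vecMul π Q = π →
          SpectralHMM.IsHMM P π Q f X Y →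
        ∀ M₀ : ℕ,
          (∀ M ∈ ℳ, M₀ ≤ M → (SpectralHMM.momentMatrix P (Φ M) Y).rank = K) →
        ∀ M ∈ ℳ, M₀ ≤ M → (∀ a, MemLp (Φ M a) ∞ μ) →
        ∀ C : ℝ, C₀ M (Φ M) ≤ C →
          (∀ n : ℕ,
            n₀ M (Φ M) (SpectralHMM.emissionMatrix (Φ M) f) * C ^ 2 * (1 + Real.log C) ≤ n →
            P.real {ω | SpectralHMM.spectralOrder (Φ M) C n (fun s => Y s ω) ≠ K}
              ≤ 1 / (n : ℝ) ^ 2) ∧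
          (∀ᵐ ω ∂P, Tendsto
            (fun n : ℕ => SpectralHMM.spectralOrder (Φ M) C n (fun s => Y s ω))
            atTop (𝓝 K))) := by
  -- The constants must be fixed before `π` is introduced. By uniqueness the stationary distribution
  -- is a function of `Q`; if there were none, any constant would do.
  have hL : ∃ L : ℝ, 0 ≤ L ∧ ∀ π ∈ stdSimplex ℝ (Fin K), Matrix.vecMul π Q = π →
      ∀ (h : Fin K → ℝ) (B : ℝ), (∀ i, |h i| ≤ B) →
      ∃ g : Fin K → ℝ, (∀ i, |g i| ≤ L * B) ∧
        ∀ i, g i - ∑ j, Q i j * g j = h i - ∑ j, π j * h j := by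
    by_cases hex : ∃ π ∈ stdSimplex ℝ (Fin K), Matrix.vecMul π Q = π
    · obtain ⟨π, hπ, hst⟩ := hex
      obtain ⟨L, hL0, hL⟩ := SpectralHMM.exists_poisson hQ hQirr hπ hst
      refine ⟨L, hL0, fun ρ hρ hst' => ?_⟩
      rw [SpectralHMM.stationary_unique hQ hQirr hπ hst hρ hst']
      exact hL
    · exact ⟨0, le_rfl, fun π hπ hst => absurd ⟨π, hπ, hst⟩ hex⟩
  obtain ⟨L, hL0, hL⟩ := hL
  -- Stating the margin for `momentFactorization π Q O`, without any probability space, makes `n₀`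
  -- depend on the densities only through `O`.
  have hn₀ : ∀ (M : ℕ) (O : Matrix (Fin M) (Fin K) ℝ), ∃ n₀ : ℝ, 3 ≤ n₀ ∧
      ∀ π ∈ stdSimplex ℝ (Fin K), Matrix.vecMul π Q = π →
      ∀ (C : ℝ) (n : ℕ), 1 ≤ C → n₀ * C ^ 2 * (1 + Real.log C) ≤ n →
      ∀ N' : Matrix (Fin M) (Fin M) ℝ,
        (∀ a b, |N' a b - SpectralHMM.momentFactorization π Q O a b| ≤
          C * Real.sqrt (Real.log n / n) / (M + 1)) →
        Nat.card {i : Fin M // C * Real.sqrt (Real.log n / n) < SpectralHMM.singularValue N' i} =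
          (SpectralHMM.momentFactorization π Q O).rank := by
    intro M O
    by_cases hex : ∃ π ∈ stdSimplex ℝ (Fin K), Matrix.vecMul π Q = π
    · obtain ⟨π, hπ, hst⟩ := hex
      obtain ⟨s, hs, hcard⟩ := SpectralHMM.exists_margin_card_singularValue
        (SpectralHMM.momentFactorization π Q O)
      obtain ⟨n₀, hn₃, hn₀⟩ := SpectralHMM.exists_two_mul_threshold_lt hs
      refine ⟨n₀, hn₃, fun ρ hρ hst' C n hC hn N' hN' => ?_⟩
      rw [SpectralHMM.stationary_unique hQ hQirr hπ hst hρ hst'] at hN' ⊢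
      refine hcard N' _ _ (by positivity) ?_ (hn₀ C n hC hn) hN'
      rw [mul_div_assoc', div_le_iff₀ (by positivity), mul_comm]
      gcongr
      linarith
    · exact ⟨3, le_rfl, fun π hπ hst => absurd ⟨π, hπ, hst⟩ hex⟩
  choose n₀ hn₃ hn₀ using hn₀
  have hC₀ : ∀ (M : ℕ) (φ : Fin M → Lp ℝ 2 μ), 1 ≤
      7 * ((M : ℝ) + 1) ^ 2 * ((6 + 2 * L) * SpectralHMM.supBound φ ^ 2) := by
    intro M φ
    have h1 : 1 ≤ ((M : ℝ) + 1) ^ 2 := one_le_pow₀ (by simp)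
    have h2 : 1 ≤ SpectralHMM.supBound φ ^ 2 := one_le_pow₀ (SpectralHMM.one_le_supBound φ)
    calc (1 : ℝ) ≤ 7 * 1 * ((6 + 2 * 0) * 1) := by norm_num
      _ ≤ _ := by gcongr
  refine ⟨fun M φ => 7 * ((M : ℝ) + 1) ^ 2 * ((6 + 2 * L) * SpectralHMM.supBound φ ^ 2),
    fun M _ O => n₀ M O, fun M φ => zero_lt_one.trans_le (hC₀ M φ),
    fun M _ O => by linarith [hn₃ M O], ?_⟩
  intro ℳ 𝔓 h𝔓 Φ hΦ f hf hfind
  constructor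
  · obtain ⟨M₀, hM₀, hinj⟩ := SpectralHMM.exists_emissionMatrix_injective h𝔓 hΦ hfind
    refine ⟨M₀, hM₀, fun Ω _ P _ π X Y hπ hst hHMM M hM hMM => ?_⟩
    rw [hHMM.momentMatrix_eq hQ hπ hf]
    refine SpectralHMM.rank_mul_mul_transpose _ _ (hinj M hM hMM) (IsUnit.mul ?_ hQinv)
    rw [Matrix.isUnit_diagonal, Pi.isUnit_iff]
    exact fun i => (SpectralHMM.stationary_pos hQ hQirr hπ hst i).ne'.isUnit
  · intro Ω _ P _ π X Y hπ hst hHMM M₀ hrank M hM hMM hbdd C hC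
    have hC1 : 1 ≤ C := (hC₀ M (Φ M)).trans hC
    have hlogC : 0 ≤ Real.log C := Real.log_nonneg hC1
    have hprob : ∀ n : ℕ,
        n₀ M (SpectralHMM.emissionMatrix (Φ M) f) * C ^ 2 * (1 + Real.log C) ≤ n →
        P.real {ω | SpectralHMM.spectralOrder (Φ M) C n (fun s => Y s ω) ≠ K} ≤
          1 / (n : ℝ) ^ 2 := by
      intro n hn
      have hn2 : 2 ≤ n := by
        have h3 := hn₃ M (SpectralHMM.emissionMatrix (Φ M) f)
        have : (3 : ℝ) ≤ n := by
          calc (3 : ℝ) = 3 * 1 ^ 2 * (1 + 0) := by norm_num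
            _ ≤ _ := by gcongr
            _ ≤ n := hn
        have : 3 ≤ n := by exact_mod_cast this
        omega
      refine (measureReal_mono ?_ (measure_ne_top _ _)).trans
        (hHMM.measureReal_exists_deviation_le hQ hπ hf hL0 (hL π hπ hst) hbdd hC hn2)
      intro ω hω
      -- Off the deviation event every entry of the empirical matrix is close to the moment matrix,
      -- so the count equals its rank, which is `K`.
      by_contra hdev
      simp only [Set.mem_ofPred_eq, not_exists, not_lt] at hdev
      refine hω ?_
      have hmom := hHMM.momentMatrix_eq hQ hπ hf (Φ M)
      have hK := hrank M hM hMM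
      rw [hmom] at hdev hK
      exact (hn₀ M _ π hπ hst C n hC1 hn _ hdev).trans hK
    refine ⟨hprob, ?_⟩
    refine SpectralHMM.ae_tendsto_of_measureReal_ne_le
      (n₁ := ⌈n₀ M (SpectralHMM.emissionMatrix (Φ M) f) * C ^ 2 * (1 + Real.log C)⌉₊)
      fun n hn => hprob n (Nat.ceil_le.1 hn)
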